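/- Let $A\in GL_k(\mathbb Z)$ be a hyperbolic integer matrix, acting on $\mathbb T^k=\mathbb R^k/\mathbb Z^k$ as a linear Anosov diffeomorphism, with real eigenvalues $|B_1|<|B_2|<\dots<|B_k|$, none of modulus $1$, and corresponding eigenvectors $v_1,\dots,v_k\in\mathbb R^k$. Let $p:\mathbb T^k\to\mathbb R$ be of class $C^{k+1}$, let $1\le l<k$, and let $\lambda\in(|B_l|,|B_{l+1}|)\cap(0,1)$. Put $$\phi(x)=\sum_{n=0}^{\infty}\lambda^n p(A^{-n}x),\qquad x\in\mathbb T^k .$$ For $x\in\mathbb T^k$ and $1\le i\le l$ let $q_{i,x}(t)=p(x+tv_i)$ for $t\in\mathbb R$, with Fourier coefficients $$(q_{i,x})_a=\lim_{T\to\infty}\frac1{2T}\int_{-T}^{T}q_{i,x}(t)e^{-iat}\,dt\qquad(a\in\mathbb R),$$ where in $e^{-iat}$ the letter $i$ is the imaginary unit. For $\sigma\in\mathbb R\setminus\{0\}$ let $$(g_{i,x})_\sigma=\sum_{n\in\mathbb Z}\lambda^n\,(q_{i,A^{-n}x})_{\sigma B_i^{\,n}} ,$$ the Fourier coefficient at $\sigma$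 of the formal series $g_{i,x}(t)=\sum_{n\in\mathbb Z}\lambda^n p(A^{-n}(x+tv_i))=\sum_{n\in\mathbb Z}\lambda^n q_{i,A^{-n}x}(B_i^{-n}t)$. We say that $g_i$ has a nonzero Fourier coefficient if $(g_{i,x})_\sigma\ne0$ for some $x\in\mathbb T^k$ and some $\sigma\neq 0$. For a nonempty totally bounded set $X$ in a metric space let $N_\delta(X)$ be the smallest number of sets of diameter at most $\delta$ that cover $X$; $\dim X=d$ means that the lower and the upper limit of $\log N_\delta(X)/(-\log\delta)$ as $\delta\to0^+$ are both equal to $d$. Let $\mathrm{graph}(\phi)\subset\mathbb T^k\times\mathbb R$ be the graph of $\phi$. 1. If for some $i\le l$ the series $g_i$ has a nonzero Fourier coefficient, then $$\dim \mathrm{graph}(\phi)=k+1-\frac{\log\lambda}{\log|B_{i_0}|},$$ where $i_0$ is the smallest $i\le l$ for which $g_i$ has a nonzero Fourier coefficient. 2. If for no $i\le l$ the series $g_i$ has a nonzero Fourier coefficient, then $\phi$ is $C^1$ and $\dim\mathrm{graph}(\phi)=k$. -/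

import Mathlib

open Filter Topology

noncomputable section

/-- The smallest number of sets of diameter at most `δ` whose union covers `X`. -/
def diamCoveringNumber {M : Type*} [PseudoMetricSpace M] (X : Set M) (δ : ℝ) : ℕ :=
  sInf {n : ℕ | ∃ U : Fin n → Set M,
    (∀ i, Metric.ediam (U i) ≤ ENNReal.ofReal δ) ∧ X ⊆ ⋃ i, U i}

/-- Lower box dimension: the lower limit of `log N_δ(X) / (- log δ)` as `δ → 0⁺`. -/
def lowerBoxDim {M : Type*} [PseudoMetricSpace M] (X : Set M) : EReal :=
  liminf (fun δ : ℝ => ((Real.log (diamCoveringNumber X δ) / (-Real.log δ) : ℝ) : EReal))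
    (𝓝[>] (0 : ℝ))

/-- Upper box dimension: the upper limit of `log N_δ(X) / (- log δ)` as `δ → 0⁺`. -/
def upperBoxDim {M : Type*} [PseudoMetricSpace M] (X : Set M) : EReal :=
  limsup (fun δ : ℝ => ((Real.log (diamCoveringNumber X δ) / (-Real.log δ) : ℝ) : EReal))
    (𝓝[>] (0 : ℝ))

/-- `X` is nonempty and totally bounded, and its box dimension exists and equals `d`. -/
def HasBoxDim {M : Type*} [PseudoMetricSpace M] (X : Set M) (d : ℝ) : Prop :=
  X.Nonempty ∧ TotallyBounded X ∧ lowerBoxDim X = (d : EReal) ∧ upperBoxDim X = (d : EReal)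

/-- The covering projection `ℝ^k → 𝕋^k = ℝ^k / ℤ^k`. -/
def torusProj {k : ℕ} (y : Fin k → ℝ) : UnitAddTorus (Fin k) :=
  fun i => (y i : UnitAddCircle)

/-- `f : 𝕋^k → ℝ` is of class `C^n`: its `ℤ^k`-periodic lift to `ℝ^k` is `C^n`
(the covering projection is a local diffeomorphism). -/
def TorusContDiff {k : ℕ} (n : ℕ) (f : UnitAddTorus (Fin k) → ℝ) : Prop :=
  ContDiff ℝ n (fun y : Fin k → ℝ => f (torusProj y))

/-- The automorphism of `𝕋^k` induced by an integer matrix that is invertible over `ℤ`. -/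
def toralMap {k : ℕ} (A : Matrix.GeneralLinearGroup (Fin k) ℤ) (x : UnitAddTorus (Fin k)) :
    UnitAddTorus (Fin k) :=
  fun i => ∑ j, (A : Matrix (Fin k) (Fin k) ℤ) i j • x j

/-- `φ(x) = ∑_{n ≥ 0} λ^n p(A^{-n} x)`. -/
def skewPhi {k : ℕ} (A : Matrix.GeneralLinearGroup (Fin k) ℤ) (lam : ℝ)
    (p : UnitAddTorus (Fin k) → ℝ) (x : UnitAddTorus (Fin k)) : ℝ :=
  ∑' n : ℕ, lam ^ n * p (toralMap (A⁻¹ ^ n) x)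

/-- The graph of a real function on the torus, inside the metric space `𝕋^k × ℝ`. -/
def torusGraph {k : ℕ} (f : UnitAddTorus (Fin k) → ℝ) : Set (UnitAddTorus (Fin k) × ℝ) :=
  {z | z.2 = f z.1}

/-- The slice `t ↦ p(x + t v)` of `p` at the base point `x` in the direction `v`. -/
def torusSlice {k : ℕ} (p : UnitAddTorus (Fin k) → ℝ) (v : Fin k → ℝ)
    (x : UnitAddTorus (Fin k)) (t : ℝ) : ℝ :=
  p (x + torusProj (t • v))

/-- The Fourier coefficient `q_a = lim_{T → ∞} (1 / 2T) ∫_{-T}^{T} q(t) e^{-iat} dt` of an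
almost periodic function. -/
def apFourierCoeff (q : ℝ → ℝ) (a : ℝ) : ℂ :=
  limUnder atTop (fun T : ℝ => (1 / (2 * (T : ℂ))) *
    ∫ t in (-T)..T, (q t : ℂ) * Complex.exp (-(Complex.I * (a : ℂ) * (t : ℂ))))

/-- Let `v` be an eigenvector of `A` with eigenvalue `b`. Since `A^{-n} v = b^{-n} v`, the slice
of `φ` at `x` in the direction `v` is `t ↦ ∑_{n ≥ 0} λ^n q_n(b^{-n} t)`, where `q_n` is the slice
of `p` at `A^{-n} x`. This is the coefficient at frequency `σ` of the associated two-sided formal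
series `g(t) = ∑_{n ∈ ℤ} λ^n q_n(b^{-n} t)`, that is `g_σ = ∑_{n ∈ ℤ} λ^n (q_n)_{σ b^n}`.
At a fixed point of `A`, such as `x = 0`, all the `q_n` are equal. -/
def gFourierCoeff {k : ℕ} (A : Matrix.GeneralLinearGroup (Fin k) ℤ) (lam : ℝ)
    (p : UnitAddTorus (Fin k) → ℝ) (b : ℝ) (v : Fin k → ℝ) (x : UnitAddTorus (Fin k))
    (σ : ℝ) : ℂ :=
  ∑' n : ℤ, (lam : ℂ) ^ n *
    apFourierCoeff (torusSlice p v (toralMap (A ^ (-n)) x)) (σ * b ^ n)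

/-- Some slice in the direction `v` has a nonzero coefficient `g_σ` at a frequency `σ ≠ 0`. -/
def HasNonzeroCoeff {k : ℕ} (A : Matrix.GeneralLinearGroup (Fin k) ℤ) (lam : ℝ)
    (p : UnitAddTorus (Fin k) → ℝ) (b : ℝ) (v : Fin k → ℝ) : Prop :=
  ∃ (x : UnitAddTorus (Fin k)) (σ : ℝ), σ ≠ 0 ∧ gFourierCoeff A lam p b v x σ ≠ 0

end

/-! Fix an eigenvector `v` with eigenvalue `b`. If `|b| > lam`, differentiating φ termwise along `v`
gives a series with ratio `lam/|b| < 1`, so φ is continuously differentiable in that direction. If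
`|b| < lam`, the central object is the two-sided increment series Δ_s(x) = ∑_{n ∈ ℤ} λ^n
(p(A^{-n}(x+sv)) - p(A^{-n}x)), called `incrementCocycle`. Its nonnegative half converges because p
is bounded and λ < 1, and is the increment of φ. Its negative half converges because p is Lipschitz
along `v` and `|b| < lam`, and is C^1 in s (`incrementCocycle_eq`). Reindexing gives the exact
scaling law Δ_{b^n s}(A^n x) = λ^n Δ_s(x) (`incrementCocycle_zpow`).

The Fourier condition detects whether Δ vanishes (`hasNonzeroCoeff_iff`). The coefficient of t ↦
Δ_s(x+tv) at σ is (e^{iσs} - 1) g_σ, and a continuous function on the torus all of whose slice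
coefficients vanish is zero (`eq_zero_of_hasMean_zero`). When Δ = 0, the increment of φ is minus the
negative half, so φ is continuously differentiable along `v`.

Put α = log λ / log|b|, so that |b|^α = λ. For the upper bound on the dimension, scaling makes φ
α-Hölder along `v` (`isHolderAlong_skewPhi`). The directions where φ is not already C^1 are those
with a nonzero coefficient, and the first of them has the least α. Hence φ is α-Hölder on the torus,
and counting boxes gives dimension at most k + 1 - α.

For the lower bound, A preserves volume, so scaling also gives ‖Δ_{b^n s}‖_1 = λ^n ‖Δ_s‖_1. The
remainder is only O(|b|^n), so the region between the graph of φ and its translate by b^n s v has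
volume at least of order λ^n. This region lies within distance O(|b|^n) of the graph, so N_δ ·
O(|b|^n)^{k+1} is at least of order λ^n when δ is comparable to |b|^n
(`integral_abs_sub_le_diamCoveringNumber_mul`). If no coefficient is nonzero, φ is C^1 along a
basis, hence C^1; its graph has dimension k by the Lipschitz upper bound and projection to the
torus. -/

noncomputable section

/-! ### The covering projection and toral automorphisms -/

theorem torusProj_add {k : ℕ} (a b : Fin k → ℝ) :
    torusProj (a + b) = torusProj a + torusProj b := by
  ext i; simp [torusProj]

theorem torusProj_zero {k : ℕ} : torusProj (0 : Fin k → ℝ) = 0 := by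
  ext i; simp [torusProj]

theorem continuous_torusProj {k : ℕ} : Continuous (torusProj (k := k)) :=
  continuous_pi fun i => (AddCircle.continuous_mk' 1).comp (continuous_apply i)

theorem surjective_torusProj {k : ℕ} : Function.Surjective (torusProj (k := k)) := by
  intro x
  choose y hy using fun i => QuotientAddGroup.mk_surjective (x i)
  exact ⟨y, funext hy⟩

theorem norm_torusProj_le {k : ℕ} (y : Fin k → ℝ) : ‖torusProj y‖ ≤ ‖y‖ := by
  refine (pi_norm_le_iff_of_nonneg (norm_nonneg y)).2 fun i => ?_
  refine le_trans ?_ (norm_le_pi_norm y i)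
  exact QuotientAddGroup.norm_mk_le_norm

/-- The automorphism `toralMap A` as a homomorphism of additive groups. -/
def toralHom {k : ℕ} (A : Matrix.GeneralLinearGroup (Fin k) ℤ) :
    UnitAddTorus (Fin k) →+ UnitAddTorus (Fin k) where
  toFun := toralMap A
  map_zero' := by ext i; simp [toralMap]
  map_add' x y := by ext i; simp [toralMap, Finset.sum_add_distrib]

theorem toralMap_add {k : ℕ} (A : Matrix.GeneralLinearGroup (Fin k) ℤ)
    (x y : UnitAddTorus (Fin k)) : toralMap A (x + y) = toralMap A x + toralMap A y :=
  (toralHom A).map_add x y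

theorem toralMap_one {k : ℕ} (x : UnitAddTorus (Fin k)) : toralMap 1 x = x := by
  ext i
  simp [toralMap, Matrix.one_apply, ite_smul]

theorem toralMap_mul {k : ℕ} (A A' : Matrix.GeneralLinearGroup (Fin k) ℤ)
    (x : UnitAddTorus (Fin k)) : toralMap (A * A') x = toralMap A (toralMap A' x) := by
  ext i
  simp only [toralMap, Matrix.GeneralLinearGroup.coe_mul, Matrix.mul_apply, Finset.sum_smul,
    Finset.smul_sum, mul_smul]
  exact Finset.sum_comm

theorem continuous_toralMap {k : ℕ} (A : Matrix.GeneralLinearGroup (Fin k) ℤ) :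
    Continuous (toralMap A) :=
  continuous_pi fun _ => continuous_finsetSum _ fun j _ =>
    (continuous_apply j).zsmul _

theorem surjective_toralMap {k : ℕ} (A : Matrix.GeneralLinearGroup (Fin k) ℤ) :
    Function.Surjective (toralMap A) := fun x =>
  ⟨toralMap A⁻¹ x, by rw [← toralMap_mul, mul_inv_cancel, toralMap_one]⟩

/-- A continuous surjective endomorphism of a compact group pushes Haar measure to an invariant
measure of the same mass. -/
theorem measurePreserving_toralMap {k : ℕ} (A : Matrix.GeneralLinearGroup (Fin k) ℤ) :
    MeasureTheory.MeasurePreserving (toralMap A) :=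
  AddMonoidHom.measurePreserving (f := toralHom A) (continuous_toralMap A)
    (surjective_toralMap A) rfl

theorem toralMap_torusProj {k : ℕ} (A : Matrix.GeneralLinearGroup (Fin k) ℤ) (y : Fin k → ℝ) :
    toralMap A (torusProj y) =
      torusProj (((A : Matrix (Fin k) (Fin k) ℤ).map (Int.cast : ℤ → ℝ)).mulVec y) := by
  ext i
  have h : ∀ f : Fin k → ℝ, ((∑ j, f j : ℝ) : UnitAddCircle) = ∑ j, (f j : UnitAddCircle) :=
    fun f => map_sum (QuotientAddGroup.mk' _) f Finset.univ
  simp only [toralMap, torusProj, Matrix.mulVec, dotProduct, Matrix.map_apply, h]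
  refine Finset.sum_congr rfl fun j _ => ?_
  rw [← AddCircle.coe_zsmul, zsmul_eq_mul]

/-- The integer inverse of `A` is also an inverse over ℝ, so `A` has no real kernel. -/
theorem eigenvalue_ne_zero {k : ℕ} {A : Matrix.GeneralLinearGroup (Fin k) ℤ} {b : ℝ}
    {v : Fin k → ℝ} (hv : v ≠ 0)
    (hA : ((A : Matrix (Fin k) (Fin k) ℤ).map (Int.cast : ℤ → ℝ)).mulVec v = b • v) : b ≠ 0 := by
  rintro rfl
  apply hv
  have h1 : ((A⁻¹ : Matrix.GeneralLinearGroup (Fin k) ℤ) : Matrix (Fin k) (Fin k) ℤ) *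
      (A : Matrix (Fin k) (Fin k) ℤ) = 1 := by
    rw [← Matrix.GeneralLinearGroup.coe_mul, inv_mul_cancel]; rfl
  have h2 : (((A⁻¹ : Matrix.GeneralLinearGroup (Fin k) ℤ) : Matrix (Fin k) (Fin k) ℤ).map
      (Int.cast : ℤ → ℝ)) * ((A : Matrix (Fin k) (Fin k) ℤ).map (Int.cast : ℤ → ℝ)) = 1 := by
    have h := congrArg (Int.castRingHom ℝ).mapMatrix h1
    rwa [map_mul, map_one] at h
  rw [← Matrix.one_mulVec v, ← h2, ← Matrix.mulVec_mulVec, hA, zero_smul, Matrix.mulVec_zero]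

theorem toralMap_zpow_torusProj {k : ℕ} {A : Matrix.GeneralLinearGroup (Fin k) ℤ} {b : ℝ}
    {v : Fin k → ℝ} (hb : b ≠ 0)
    (hA : ((A : Matrix (Fin k) (Fin k) ℤ).map (Int.cast : ℤ → ℝ)).mulVec v = b • v)
    (n : ℤ) (t : ℝ) :
    toralMap (A ^ n) (torusProj (t • v)) = torusProj ((b ^ n * t) • v) := by
  have h1 : ∀ t : ℝ, toralMap A (torusProj (t • v)) = torusProj ((b * t) • v) := fun t => by
    rw [toralMap_torusProj, Matrix.mulVec_smul, hA, smul_smul, mul_comm]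
  have h2 : ∀ t : ℝ, toralMap A⁻¹ (torusProj (t • v)) = torusProj ((b⁻¹ * t) • v) := fun t => by
    have h3 := h1 (b⁻¹ * t)
    rw [mul_inv_cancel_left₀ hb] at h3
    rw [← h3, ← toralMap_mul, inv_mul_cancel, toralMap_one]
  induction n generalizing t with
  | zero => simp [toralMap_one]
  | succ n ih => rw [zpow_add_one, toralMap_mul, h1, ih, zpow_add_one₀ hb, mul_assoc]
  | pred n ih => rw [zpow_sub_one, toralMap_mul, h2, ih, zpow_sub_one₀ hb, mul_assoc]

/-! ### Characters of the torus -/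

theorem UnitAddTorus.mFourierCoeff_eq_integral_volume {k : ℕ} (f : UnitAddTorus (Fin k) → ℂ)
    (n : Fin k → ℤ) : mFourierCoeff f n = ∫ t, mFourier (-n) t • f t := by
  have h : (MeasureTheory.volume : MeasureTheory.Measure UnitAddCircle) =
      AddCircle.haarAddCircle :=
    (AddCircle.volume_eq_smul_haarAddCircle (T := 1)).trans (by simp)
  change ∫ t, _ ∂(MeasureTheory.Measure.pi fun _ : Fin k => AddCircle.haarAddCircle) =
    ∫ t, _ ∂(MeasureTheory.Measure.pi fun _ : Fin k => MeasureTheory.volume)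
  rw [h]

theorem UnitAddTorus.mFourier_apply_add {k : ℕ} (n : Fin k → ℤ) (x y : UnitAddTorus (Fin k)) :
    mFourier n (x + y) = mFourier n x * mFourier n y := by
  simp [mFourier, fourier_apply, smul_add, AddCircle.toCircle_add, Finset.prod_mul_distrib]

theorem UnitAddTorus.mFourier_torusProj_smul {k : ℕ} (n : Fin k → ℤ) (v : Fin k → ℝ) (t : ℝ) :
    mFourier n (torusProj (t • v)) =
      Complex.exp (Complex.I * ((2 * Real.pi * ∑ i, n i * v i : ℝ) : ℂ) * t) := by
  simp only [mFourier, torusProj, ContinuousMap.coe_mk, fourier_coe_apply, Pi.smul_apply,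
    smul_eq_mul, ← Complex.exp_sum]
  congr 1
  push_cast
  simp only [Finset.mul_sum, Finset.sum_mul]
  exact Finset.sum_congr rfl fun i _ => by ring

/-! ### Fourier coefficients of functions on the line as limits of window means -/

/-- The mean of `t ↦ q t * exp (-i a t)` over the window `[-T, T]`. -/
def windowMean (q : ℝ → ℂ) (a T : ℝ) : ℂ :=
  (1 / (2 * (T : ℂ))) * ∫ t in (-T)..T, q t * Complex.exp (-(Complex.I * (a : ℂ) * (t : ℂ)))

/-- The Fourier coefficient of `q` at the frequency `a` exists and equals `L`. -/
def HasMean (q : ℝ → ℂ) (a : ℝ) (L : ℂ) : Prop := Tendsto (windowMean q a) atTop (𝓝 L)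

theorem HasMean.apFourierCoeff_eq {q : ℝ → ℝ} {a : ℝ} {L : ℂ}
    (h : HasMean (fun t => (q t : ℂ)) a L) : apFourierCoeff q a = L :=
  Tendsto.limUnder_eq h

theorem HasMean.unique {q : ℝ → ℂ} {a : ℝ} {L L' : ℂ} (h : HasMean q a L) (h' : HasMean q a L') :
    L = L' :=
  tendsto_nhds_unique h h'

theorem hasMean_zero (a : ℝ) : HasMean (fun _ => 0) a 0 :=
  tendsto_const_nhds.congr fun T => by simp [windowMean]

theorem norm_exp_neg_I_mul_mul (a t : ℝ) :
    ‖Complex.exp (-(Complex.I * (a : ℂ) * (t : ℂ)))‖ = 1 := by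
  rw [show -(Complex.I * (a : ℂ) * (t : ℂ)) = ((-(a * t) : ℝ) : ℂ) * Complex.I by push_cast; ring]
  exact Complex.norm_exp_ofReal_mul_I _

theorem norm_windowMean_le {q : ℝ → ℂ} {M : ℝ} (hq : ∀ t, ‖q t‖ ≤ M) (a : ℝ) {T : ℝ}
    (hT : 0 < T) : ‖windowMean q a T‖ ≤ M := by
  have h := intervalIntegral.norm_integral_le_of_norm_le_const (a := -T) (b := T) (C := M)
    (f := fun t => q t * Complex.exp (-(Complex.I * (a : ℂ) * (t : ℂ))))
    (fun t _ => by rw [norm_mul, norm_exp_neg_I_mul_mul, mul_one]; exact hq t)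
  rw [show |T - -T| = 2 * T by rw [abs_of_pos] <;> linarith] at h
  rw [windowMean, norm_mul]
  have : ‖1 / (2 * (T : ℂ))‖ = 1 / (2 * T) := by
    simp [abs_of_pos hT]
  rw [this]
  calc _ ≤ 1 / (2 * T) * (M * (2 * T)) := by gcongr
    _ = M := by field_simp

theorem intervalIntegrable_mul_exp {q : ℝ → ℂ} (hq : Continuous q) (a x y : ℝ) :
    IntervalIntegrable (fun t => q t * Complex.exp (-(Complex.I * (a : ℂ) * (t : ℂ))))
      MeasureTheory.volume x y := by
  apply Continuous.intervalIntegrable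
  fun_prop

theorem windowMean_add {q r : ℝ → ℂ} (hq : Continuous q) (hr : Continuous r) (a T : ℝ) :
    windowMean (fun t => q t + r t) a T = windowMean q a T + windowMean r a T := by
  simp only [windowMean, add_mul]
  rw [intervalIntegral.integral_add (intervalIntegrable_mul_exp hq _ _ _)
    (intervalIntegrable_mul_exp hr _ _ _), mul_add]

theorem windowMean_const_mul (c : ℂ) (q : ℝ → ℂ) (a T : ℝ) :
    windowMean (fun t => c * q t) a T = c * windowMean q a T := by
  simp only [windowMean, mul_assoc]
  rw [intervalIntegral.integral_const_mul]
  ring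

theorem HasMean.add {q r : ℝ → ℂ} (hq : Continuous q) (hr : Continuous r) {a : ℝ} {L M : ℂ}
    (h : HasMean q a L) (h' : HasMean r a M) : HasMean (fun t => q t + r t) a (L + M) := by
  unfold HasMean at *
  rw [show windowMean (fun t => q t + r t) a = fun T => windowMean q a T + windowMean r a T from
    funext fun T => windowMean_add hq hr a T]
  exact Tendsto.add h h'

theorem HasMean.const_mul {q : ℝ → ℂ} {a : ℝ} {L : ℂ} (h : HasMean q a L) (c : ℂ) :
    HasMean (fun t => c * q t) a (c * L) := by
  unfold HasMean at *
  rw [show windowMean (fun t => c * q t) a = fun T => c * windowMean q a T from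
    funext fun T => windowMean_const_mul c q a T]
  exact Tendsto.const_mul c h

/-- The substitution turns the window of half-length T into one of half-length |b|T. For negative b
the reversed orientation cancels the sign of 1/b. -/
theorem HasMean.comp_mul {q : ℝ → ℂ} {a : ℝ} {L : ℂ} (h : HasMean q a L) {b : ℝ} (hb : b ≠ 0) :
    HasMean (fun t => q (b * t)) (b * a) L := by
  have key : ∀ T, 0 < T → windowMean (fun t => q (b * t)) (b * a) T = windowMean q a (|b| * T) := by
    intro T hT
    have h1 := intervalIntegral.integral_comp_mul_left (a := -T) (b := T)
      (fun t => q t * Complex.exp (-(Complex.I * (a : ℂ) * (t : ℂ)))) hb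
    have h2 : (fun t : ℝ => q (b * t) * Complex.exp (-(Complex.I * ((b * a : ℝ) : ℂ) * (t : ℂ)))) =
      fun t : ℝ => q (b * t) * Complex.exp (-(Complex.I * (a : ℂ) * ((b * t : ℝ) : ℂ))) := by
      funext t; congr 2; push_cast; ring
    have hbC : (b : ℂ) ≠ 0 := by exact_mod_cast hb
    have hTC : (T : ℂ) ≠ 0 := by exact_mod_cast hT.ne'
    rw [windowMean, windowMean, h2, h1, Complex.real_smul]
    rcases abs_cases b with ⟨e, _⟩ | ⟨e, _⟩
    · rw [e, show b * -T = -(b * T) by ring]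
      push_cast
      field_simp
    · rw [e, intervalIntegral.integral_symm, show b * -T = -b * T by ring,
        show b * T = -(-b * T) by ring]
      push_cast
      field_simp
  have h3 : Tendsto (fun T : ℝ => |b| * T) atTop atTop :=
    tendsto_id.const_mul_atTop (abs_pos.2 hb)
  refine (Tendsto.comp h h3).congr' ?_
  filter_upwards [eventually_gt_atTop 0] with T hT
  exact (key T hT).symm

theorem HasMean.comp_add {q : ℝ → ℂ} (hq : Continuous q) {M : ℝ} (hM : ∀ t, ‖q t‖ ≤ M)
    {a : ℝ} {L : ℂ} (h : HasMean q a L) (s : ℝ) :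
    HasMean (fun t => q (t + s)) a (Complex.exp (Complex.I * a * s) * L) := by
  set f : ℝ → ℂ := fun t => q t * Complex.exp (-(Complex.I * (a : ℂ) * (t : ℂ))) with hf
  have hi : ∀ x y, IntervalIntegrable f MeasureTheory.volume x y :=
    fun x y => intervalIntegrable_mul_exp hq a x y
  have hfM : ∀ t, ‖f t‖ ≤ M := fun t => by
    rw [hf, norm_mul, norm_exp_neg_I_mul_mul, mul_one]; exact hM t
  have key : ∀ T, 0 < T → ‖windowMean (fun t => q (t + s)) a T -
      Complex.exp (Complex.I * a * s) * windowMean q a T‖ ≤ (M * |s|) * T⁻¹ := by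
    intro T hT
    have h1 : (fun t : ℝ => q (t + s) * Complex.exp (-(Complex.I * (a : ℂ) * (t : ℂ)))) =
        fun t : ℝ => Complex.exp (Complex.I * a * s) * f (t + s) := by
      funext t
      rw [hf, mul_left_comm, ← Complex.exp_add]
      congr 2; push_cast; ring
    -- The original and shifted windows agree except for two end intervals of length |s|, which the
    -- factor 1/(2T) makes negligible.
    have h2 : windowMean (fun t => q (t + s)) a T -
        Complex.exp (Complex.I * a * s) * windowMean q a T =
        Complex.exp (Complex.I * a * s) * ((1 / (2 * (T : ℂ))) *
          ((∫ t in T..(T + s), f t) - ∫ t in (-T)..(-T + s), f t)) := by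
      rw [windowMean, windowMean, h1, intervalIntegral.integral_const_mul,
        intervalIntegral.integral_comp_add_right,
        ← intervalIntegral.integral_interval_sub_interval_comm' (hi _ _) (hi _ _) (hi _ _)]
      ring
    have h3 : ‖Complex.exp (Complex.I * a * s)‖ = 1 := by
      rw [show Complex.I * (a : ℂ) * (s : ℂ) = ((a * s : ℝ) : ℂ) * Complex.I by push_cast; ring]
      exact Complex.norm_exp_ofReal_mul_I _
    have h4 : ‖1 / (2 * (T : ℂ))‖ = 1 / (2 * T) := by simp [abs_of_pos hT]
    have h5 : ∀ x, ‖∫ t in x..(x + s), f t‖ ≤ M * |s| := fun x => by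
      have := intervalIntegral.norm_integral_le_of_norm_le_const (a := x) (b := x + s) (C := M)
        (f := f) (fun t _ => hfM t)
      simpa using this
    rw [h2, norm_mul, h3, one_mul, norm_mul, h4]
    calc _ ≤ 1 / (2 * T) * (M * |s| + M * |s|) := by
          gcongr
          exact (norm_sub_le _ _).trans (add_le_add (h5 _) (h5 _))
      _ = _ := by field_simp; ring
  have h6 : Tendsto (fun T => windowMean (fun t => q (t + s)) a T -
      Complex.exp (Complex.I * a * s) * windowMean q a T) atTop (𝓝 0) := by
    refine squeeze_zero_norm' (a := fun T => (M * |s|) * T⁻¹) ?_ ?_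
    · filter_upwards [eventually_gt_atTop 0] with T hT using key T hT
    · simpa using tendsto_inv_atTop_zero.const_mul (M * |s|)
  have h7 := h6.add (Tendsto.const_mul (Complex.exp (Complex.I * a * s)) h)
  rw [zero_add] at h7
  exact h7.congr fun T => by simp

/-- Dominated convergence is used twice: to integrate the series over each window, and to let T tend
to infinity under the sum. -/
theorem hasMean_tsum {ι : Type*} [Countable ι] {q : ι → ℝ → ℂ} {L : ι → ℂ} {u : ι → ℝ}
    (hq : ∀ n, Continuous (q n)) (hu : Summable u) (hb : ∀ n t, ‖q n t‖ ≤ u n) {a : ℝ}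
    (h : ∀ n, HasMean (q n) a (L n)) : HasMean (fun t => ∑' n, q n t) a (∑' n, L n) := by
  have h1 : ∀ T, 0 < T → ∑' n, windowMean (q n) a T = windowMean (fun t => ∑' n, q n t) a T := by
    intro T hT
    have h2 := intervalIntegral.hasSum_integral_of_dominated_convergence (ι := ι) (a := -T) (b := T)
      (μ := MeasureTheory.volume)
      (F := fun n t => q n t * Complex.exp (-(Complex.I * (a : ℂ) * (t : ℂ))))
      (f := fun t => (∑' n, q n t) * Complex.exp (-(Complex.I * (a : ℂ) * (t : ℂ))))
      (fun n _ => u n)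
      (fun n => Continuous.aestronglyMeasurable (by have := hq n; fun_prop))
      (fun n => Eventually.of_forall fun t _ => by
        rw [norm_mul, norm_exp_neg_I_mul_mul, mul_one]; exact hb n t)
      (Eventually.of_forall fun t _ => hu)
      (by simp)
      (Eventually.of_forall fun t _ => by
        exact (Summable.of_norm_bounded hu fun n => hb n t).hasSum.mul_right _)
    exact (h2.mul_left (1 / (2 * (T : ℂ)))).tsum_eq
  refine Tendsto.congr' (f₁ := fun T => ∑' n, windowMean (q n) a T) ?_ ?_
  · filter_upwards [eventually_gt_atTop 0] with T hT using h1 T hT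
  · refine tendsto_tsum_of_dominated_convergence hu h ?_
    filter_upwards [eventually_gt_atTop 0] with T hT n
    exact norm_windowMean_le (hb n) a hT

theorem hasMean_exp (w a : ℝ) :
    HasMean (fun t => Complex.exp (Complex.I * w * t)) a (if w = a then 1 else 0) := by
  have h0 : ∀ t : ℝ, Complex.exp (Complex.I * w * t) *
      Complex.exp (-(Complex.I * (a : ℂ) * (t : ℂ))) =
      Complex.exp ((Complex.I * ((w - a : ℝ) : ℂ)) * t) := fun t => by
    rw [← Complex.exp_add]; congr 1; push_cast; ring
  split_ifs with hwa
  · subst hwa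
    refine tendsto_const_nhds.congr' ?_
    filter_upwards [eventually_gt_atTop 0] with T hT
    have hTC : (T : ℂ) ≠ 0 := by exact_mod_cast hT.ne'
    simp only [windowMean, h0, sub_self, Complex.ofReal_zero, mul_zero, zero_mul, Complex.exp_zero,
      intervalIntegral.integral_const, Complex.real_smul]
    push_cast
    field_simp
    ring
  · have hd : w - a ≠ 0 := sub_ne_zero.2 hwa
    have hc : Complex.I * ((w - a : ℝ) : ℂ) ≠ 0 :=
      mul_ne_zero Complex.I_ne_zero (by exact_mod_cast hd)
    refine squeeze_zero_norm' (a := fun T : ℝ => |w - a|⁻¹ * T⁻¹) ?_ ?_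
    · filter_upwards [eventually_gt_atTop 0] with T hT
      have h4 : ‖1 / (2 * (T : ℂ))‖ = 1 / (2 * T) := by simp [abs_of_pos hT]
      have h5 : ∀ t : ℝ, ‖Complex.exp ((Complex.I * ((w - a : ℝ) : ℂ)) * t)‖ = 1 := fun t => by
        rw [show Complex.I * ((w - a : ℝ) : ℂ) * (t : ℂ) = (((w - a) * t : ℝ) : ℂ) * Complex.I by
          push_cast; ring]
        exact Complex.norm_exp_ofReal_mul_I _
      have h6 : ‖Complex.I * ((w - a : ℝ) : ℂ)‖ = |w - a| := by
        rw [norm_mul, Complex.norm_I, one_mul, Complex.norm_real, Real.norm_eq_abs]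
      simp only [windowMean, h0]
      rw [integral_exp_mul_complex hc, norm_mul, h4, norm_div, h6]
      calc _ ≤ 1 / (2 * T) * ((1 + 1) / |w - a|) := by
            gcongr
            exact (norm_sub_le _ _).trans (add_le_add (h5 _).le (h5 _).le)
        _ = _ := by field_simp; ring
    · simpa using tendsto_inv_atTop_zero.const_mul (|w - a|⁻¹)

/-! ### Slices of continuous functions on the torus: existence and uniqueness of coefficients -/

theorem continuous_slice {k : ℕ} {E : Type*} [TopologicalSpace E] {F : UnitAddTorus (Fin k) → E}
    (hF : Continuous F) (v : Fin k → ℝ) (x : UnitAddTorus (Fin k)) :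
    Continuous fun t : ℝ => F (x + torusProj (t • v)) :=
  hF.comp (continuous_const.add (continuous_torusProj.comp (by fun_prop)))

theorem hasMean_mFourier {k : ℕ} (m : Fin k → ℤ) (v : Fin k → ℝ) (x : UnitAddTorus (Fin k))
    (a : ℝ) : ∃ L, HasMean (fun t => UnitAddTorus.mFourier m (x + torusProj (t • v))) a L := by
  simp only [UnitAddTorus.mFourier_apply_add, UnitAddTorus.mFourier_torusProj_smul]
  exact ⟨_, (hasMean_exp _ a).const_mul _⟩

/-- The continuous functions on the torus whose slice at `x` in the direction `v` has a Fourier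
coefficient at the frequency `a`. -/
def hasMeanSubmodule {k : ℕ} (v : Fin k → ℝ) (x : UnitAddTorus (Fin k)) (a : ℝ) :
    Submodule ℂ C(UnitAddTorus (Fin k), ℂ) where
  carrier := {F | ∃ L, HasMean (fun t => F (x + torusProj (t • v))) a L}
  add_mem' := by
    rintro F G ⟨L, hL⟩ ⟨M, hM⟩
    exact ⟨L + M, hL.add (continuous_slice F.continuous v x) (continuous_slice G.continuous v x) hM⟩
  zero_mem' := ⟨0, hasMean_zero a⟩
  smul_mem' := by
    rintro c F ⟨L, hL⟩
    exact ⟨c * L, hL.const_mul c⟩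

/-- Window means are 1-Lipschitz in the sup norm, uniformly in T > 0, so the Cauchy property passes
to uniform limits. -/
theorem isClosed_hasMeanSubmodule {k : ℕ} (v : Fin k → ℝ) (x : UnitAddTorus (Fin k)) (a : ℝ) :
    IsClosed (hasMeanSubmodule v x a : Set C(UnitAddTorus (Fin k), ℂ)) := by
  refine isClosed_of_closure_subset fun F hF => ?_
  suffices CauchySeq (windowMean (fun t => F (x + torusProj (t • v))) a) from
    cauchySeq_tendsto_of_complete this
  rw [Metric.cauchySeq_iff']
  intro ε hε
  obtain ⟨G, ⟨L, hL⟩, hG⟩ := Metric.mem_closure_iff.1 hF (ε / 3) (by positivity)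
  have hc : CauchySeq (windowMean (fun t => G (x + torusProj (t • v))) a) := hL.cauchySeq
  obtain ⟨N, hN⟩ := Metric.cauchySeq_iff'.1 hc (ε / 3) (by positivity)
  obtain ⟨N', hN'⟩ := Metric.cauchySeq_iff.1 hc (ε / 3) (by positivity)
  have hd : ∀ T, 0 < T → dist (windowMean (fun t => F (x + torusProj (t • v))) a T)
      (windowMean (fun t => G (x + torusProj (t • v))) a T) < ε / 3 := by
    intro T hT
    have h1 : windowMean (fun t => F (x + torusProj (t • v))) a T -
        windowMean (fun t => G (x + torusProj (t • v))) a T =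
        windowMean (fun t => (F - G) (x + torusProj (t • v))) a T := by
      have := windowMean_add (continuous_slice (F - G).continuous v x)
        (continuous_slice G.continuous v x) a T
      rw [eq_comm, eq_sub_iff_add_eq, ← this]
      simp
    rw [dist_eq_norm, h1]
    refine (norm_windowMean_le (fun t => (F - G).norm_coe_le_norm _) a hT).trans_lt ?_
    rwa [← dist_eq_norm]
  -- The maximum with 1 keeps T positive, as the bound on window means requires.
  refine ⟨max N' 1, fun T hT => ?_⟩
  have hT1 : 0 < T := lt_of_lt_of_le one_pos ((le_max_right _ _).trans hT)
  have hT2 : 0 < max N' 1 := lt_of_lt_of_le one_pos (le_max_right _ _)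
  have e1 := hd T hT1
  have e2 := hd _ hT2
  have e3 := hN' T ((le_max_left _ _).trans hT) _ (le_max_left N' 1)
  rw [dist_comm] at e2
  have := dist_triangle4 (windowMean (fun t => F (x + torusProj (t • v))) a T)
    (windowMean (fun t => G (x + torusProj (t • v))) a T)
    (windowMean (fun t => G (x + torusProj (t • v))) a (max N' 1))
    (windowMean (fun t => F (x + torusProj (t • v))) a (max N' 1))
  linarith

/-- Characters have coefficients along every line, and their span is dense. This guarantees that
`apFourierCoeff` of a slice is a true limit, not the default value of `limUnder`. -/
theorem exists_hasMean_slice {k : ℕ} (F : C(UnitAddTorus (Fin k), ℂ)) (v : Fin k → ℝ)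
    (x : UnitAddTorus (Fin k)) (a : ℝ) : ∃ L, HasMean (fun t => F (x + torusProj (t • v))) a L := by
  have h0 : Submodule.span ℂ (Set.range UnitAddTorus.mFourier) ≤ hasMeanSubmodule v x a := by
    rw [Submodule.span_le]
    rintro _ ⟨m, rfl⟩
    exact hasMean_mFourier m v x a
  have h := Submodule.topologicalClosure_minimal _ h0 (isClosed_hasMeanSubmodule v x a)
  rw [UnitAddTorus.span_mFourier_closure_eq_top] at h
  exact h (Submodule.mem_top (x := F))

theorem continuous_windowMean_slice {k : ℕ} (F : C(UnitAddTorus (Fin k), ℂ)) (v : Fin k → ℝ)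
    (a T : ℝ) : Continuous fun x => windowMean (fun t => F (x + torusProj (t • v))) a T := by
  unfold windowMean
  refine continuous_const.mul
    (intervalIntegral.continuous_parametric_intervalIntegral_of_continuous' ?_ _ _)
  have := continuous_torusProj (k := k)
  have := F.continuous
  simp only [Function.uncurry_def]
  fun_prop

/-- After exchanging integrals, translation invariance makes the inner integral independent of t, so
the identity is exact for each window. Characters sharing a frequency along `v` are separated by
integrating over all x. -/
theorem integral_windowMean_mul_mFourier {k : ℕ} (F : C(UnitAddTorus (Fin k), ℂ))
    (m : Fin k → ℤ) (v : Fin k → ℝ) {T : ℝ} (hT : 0 < T) :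
    ∫ x, windowMean (fun t => F (x + torusProj (t • v))) (2 * Real.pi * ∑ i, m i * v i) T *
      UnitAddTorus.mFourier (-m) x = UnitAddTorus.mFourierCoeff F m := by
  set a : ℝ := 2 * Real.pi * ∑ i, m i * v i with ha
  set f : ℝ → UnitAddTorus (Fin k) → ℂ := fun t x =>
    F (x + torusProj (t • v)) * Complex.exp (-(Complex.I * (a : ℂ) * (t : ℂ))) *
      UnitAddTorus.mFourier (-m) x with hf
  have hcont : Continuous (Function.uncurry f) := by
    have := continuous_torusProj (k := k)
    have := F.continuous
    have := (UnitAddTorus.mFourier (-m)).continuous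
    simp only [Function.uncurry_def, hf]
    fun_prop
  have hbd : ∀ z, ‖Function.uncurry f z‖ ≤ ‖F‖ := by
    rintro ⟨t, x⟩
    simp only [Function.uncurry_apply_pair, hf]
    rw [norm_mul, norm_mul, norm_exp_neg_I_mul_mul, mul_one]
    have h1 := (UnitAddTorus.mFourier (-m)).norm_coe_le_norm x
    rw [UnitAddTorus.mFourier_norm] at h1
    calc _ ≤ ‖F‖ * 1 := by gcongr; exact F.norm_coe_le_norm _
      _ = _ := mul_one _
  have hfin : MeasureTheory.IsFiniteMeasure
      (MeasureTheory.volume.restrict (Set.uIoc (-T) T)) := ⟨by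
    rw [MeasureTheory.Measure.restrict_apply_univ, Set.uIoc_of_le (by linarith)]
    exact measure_Ioc_lt_top⟩
  have hswap := MeasureTheory.intervalIntegral_integral_swap (a := -T) (b := T) (f := f)
    (μ := MeasureTheory.volume)
    (MeasureTheory.Integrable.of_bound hcont.aestronglyMeasurable ‖F‖
      (Eventually.of_forall hbd))
  have hinner : ∀ t, ∫ x, f t x = UnitAddTorus.mFourierCoeff F m := by
    intro t
    rw [UnitAddTorus.mFourierCoeff_eq_integral_volume]
    rw [← MeasureTheory.integral_add_right_eq_self (μ := MeasureTheory.volume)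
      (fun x => UnitAddTorus.mFourier (-m) x • F x) (torusProj (t • v))]
    refine MeasureTheory.integral_congr_ae (Eventually.of_forall fun x => ?_)
    simp only [hf, UnitAddTorus.mFourier_apply_add, UnitAddTorus.mFourier_torusProj_smul,
      smul_eq_mul]
    have : Complex.I * ((2 * Real.pi * ∑ i, ((-m) i : ℤ) * v i : ℝ) : ℂ) * (t : ℂ) =
        -(Complex.I * (a : ℂ) * (t : ℂ)) := by
      rw [ha]; simp [Finset.sum_neg_distrib]
    rw [this]
    ring
  simp only [hinner] at hswap
  have h2 : ∀ x, windowMean (fun t => F (x + torusProj (t • v))) a T *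
      UnitAddTorus.mFourier (-m) x = (1 / (2 * (T : ℂ))) * ∫ t in (-T)..T, f t x := fun x => by
    simp only [windowMean, hf]
    rw [intervalIntegral.integral_mul_const, mul_assoc]
  simp only [h2]
  rw [MeasureTheory.integral_const_mul, ← hswap, intervalIntegral.integral_const,
    Complex.real_smul]
  have hTC : (T : ℂ) ≠ 0 := by exact_mod_cast hT.ne'
  push_cast
  field_simp
  ring

theorem eq_zero_of_hasMean_zero {k : ℕ} (F : C(UnitAddTorus (Fin k), ℂ)) (v : Fin k → ℝ)
    (h : ∀ x a, HasMean (fun t => F (x + torusProj (t • v))) a 0) : F = 0 := by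
  have hz : UnitAddTorus.mFourierCoeff F = 0 := by
    ext m
    set a : ℝ := 2 * Real.pi * ∑ i, m i * v i with ha
    have h1 : Tendsto (fun T : ℝ => ∫ x, windowMean (fun t => F (x + torusProj (t • v))) a T *
        UnitAddTorus.mFourier (-m) x) atTop (𝓝 (∫ _ : UnitAddTorus (Fin k), (0 : ℂ))) := by
      refine MeasureTheory.tendsto_integral_filter_of_dominated_convergence (fun _ => ‖F‖) ?_ ?_
        (MeasureTheory.integrable_const _) ?_
      · exact Eventually.of_forall fun T => ((continuous_windowMean_slice F v a T).mul
          (UnitAddTorus.mFourier (-m)).continuous).aestronglyMeasurable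
      · filter_upwards [eventually_gt_atTop 0] with T hT
        refine Eventually.of_forall fun x => ?_
        have h1 := (UnitAddTorus.mFourier (-m)).norm_coe_le_norm x
        rw [UnitAddTorus.mFourier_norm] at h1
        rw [norm_mul]
        calc _ ≤ ‖F‖ * 1 := by
              gcongr
              exact norm_windowMean_le (fun t => F.norm_coe_le_norm _) a hT
          _ = _ := mul_one _
      · refine Eventually.of_forall fun x => ?_
        have := Tendsto.mul_const (UnitAddTorus.mFourier (-m) x) (h x a)
        rwa [zero_mul] at this
    rw [MeasureTheory.integral_zero] at h1
    refine tendsto_nhds_unique (tendsto_const_nhds.congr' ?_) h1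
    filter_upwards [eventually_gt_atTop 0] with T hT
    exact (integral_windowMean_mul_mFourier F m v hT).symm
  ext x
  have hs := UnitAddTorus.hasSum_mFourier_series_apply_of_summable (f := F)
    (by rw [hz]; exact summable_zero) x
  simp only [hz, Pi.zero_apply, smul_eq_mul, zero_mul] at hs
  exact hs.unique hasSum_zero

/-! ### Regularity on the torus and directional derivatives -/

theorem isQuotientMap_torusProj {k : ℕ} : IsQuotientMap (torusProj (k := k)) := by
  have h : IsOpenMap (torusProj (k := k)) :=
    IsOpenMap.piMap (fun _ => QuotientAddGroup.isOpenMap_coe) (Eventually.of_forall fun _ =>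
      QuotientAddGroup.mk_surjective)
  exact h.isQuotientMap continuous_torusProj surjective_torusProj

theorem TorusContDiff.continuous {k n : ℕ} {f : UnitAddTorus (Fin k) → ℝ}
    (hf : TorusContDiff n f) : Continuous f :=
  isQuotientMap_torusProj.continuous_iff.2 (ContDiff.continuous hf)

theorem exists_norm_le_of_continuous {k : ℕ} {f : UnitAddTorus (Fin k) → ℝ} (hf : Continuous f) :
    ∃ M, 0 < M ∧ ∀ x, |f x| ≤ M := by
  obtain ⟨M, hM⟩ := isCompact_univ.exists_bound_of_continuousOn hf.continuousOn
  exact ⟨max M 1, by positivity, fun x => (hM x trivial).trans (le_max_left _ _)⟩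

/-- `f` is continuously differentiable in the direction `v`, with derivative `D`. -/
def HasContDerivAlong {k : ℕ} (f : UnitAddTorus (Fin k) → ℝ) (v : Fin k → ℝ)
    (D : UnitAddTorus (Fin k) → ℝ) : Prop :=
  Continuous D ∧ ∀ x t, HasDerivAt (fun t : ℝ => f (x + torusProj (t • v)))
    (D (x + torusProj (t • v))) t

theorem TorusContDiff.exists_hasContDerivAlong {k n : ℕ} {f : UnitAddTorus (Fin k) → ℝ}
    (hf : TorusContDiff n f) (hn : 1 ≤ n) (v : Fin k → ℝ) : ∃ D, HasContDerivAlong f v D := by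
  set P : (Fin k → ℝ) → ℝ := fun y => f (torusProj y) with hP
  have hP1 : ContDiff ℝ 1 P := ContDiff.of_le hf (by exact_mod_cast hn)
  have hline : ∀ y t, HasDerivAt (fun t : ℝ => f (torusProj y + torusProj (t • v)))
      (fderiv ℝ P (y + t • v) v) t := by
    intro y t
    have h1 : HasDerivAt (fun t : ℝ => y + t • v) v t := by
      simpa using ((hasDerivAt_id t).smul_const v).const_add y
    have h2 := ((hP1.differentiable one_ne_zero) (y + t • v)).hasFDerivAt.comp_hasDerivAt t h1
    refine h2.congr_of_eventuallyEq (Eventually.of_forall fun s => ?_)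
    simp [hP, torusProj_add]
  have hlift : ∀ y, deriv (fun t : ℝ => f (torusProj y + torusProj (t • v))) 0 =
      fderiv ℝ P y v := fun y => by
    simpa using (hline y 0).deriv
  refine ⟨fun x => deriv (fun t : ℝ => f (x + torusProj (t • v))) 0, ?_, fun x t => ?_⟩
  · rw [isQuotientMap_torusProj.continuous_iff]
    simp only [Function.comp_def, hlift]
    exact (hP1.continuous_fderiv one_ne_zero).clm_apply continuous_const
  · obtain ⟨y, rfl⟩ := surjective_torusProj x
    rw [← torusProj_add]
    beta_reduce
    rw [hlift]
    exact hline y t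

theorem abs_sub_le_of_hasDerivAt {f f' : ℝ → ℝ} {C : ℝ} (h : ∀ t, HasDerivAt f (f' t) t)
    (hC : ∀ t, |f' t| ≤ C) (s t : ℝ) : |f t - f s| ≤ C * |t - s| := by
  have := Convex.norm_image_sub_le_of_norm_hasDerivWithin_le (s := Set.univ) (x := s) (y := t)
    (fun x _ => (h x).hasDerivWithinAt) (fun x _ => hC x) convex_univ trivial trivial
  exact this

theorem HasContDerivAlong.exists_abs_sub_le {k : ℕ} {f D : UnitAddTorus (Fin k) → ℝ}
    {v : Fin k → ℝ} (h : HasContDerivAlong f v D) :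
    ∃ C, 0 < C ∧ ∀ x t, |f (x + torusProj (t • v)) - f x| ≤ C * |t| := by
  obtain ⟨C, hC0, hC⟩ := exists_norm_le_of_continuous h.1
  refine ⟨C, hC0, fun x t => ?_⟩
  simpa [torusProj_zero] using abs_sub_le_of_hasDerivAt (h.2 x) (fun t => hC _) 0 t

/-! ### Termwise differentiation of series of increments -/

section Series

variable {k : ℕ} {p D : UnitAddTorus (Fin k) → ℝ} {v : Fin k → ℝ}
  {A' : ℕ → Matrix.GeneralLinearGroup (Fin k) ℤ} {μ b' : ℕ → ℝ}

/-- The section is applied to both halves of ℤ: `A' n = A⁻¹ ^ n` with weights `lam ^ n` when `lam <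
|b|`, and `A' n = A ^ (n + 1)` with weights `(lam ^ (n + 1))⁻¹` when `|b| < lam`. Working with
increments avoids needing the series of values to converge, which can fail in the second case. -/
theorem summable_increments (hp : HasContDerivAlong p v D)
    (hA' : ∀ n t, toralMap (A' n) (torusProj (t • v)) = torusProj ((b' n * t) • v))
    (hs : Summable fun n => |μ n * b' n|) (x : UnitAddTorus (Fin k)) (t : ℝ) :
    Summable fun n => μ n * (p (toralMap (A' n) (x + torusProj (t • v))) -
      p (toralMap (A' n) x)) := by
  obtain ⟨C, hC0, hC⟩ := hp.exists_abs_sub_le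
  refine Summable.of_norm_bounded (hs.mul_left (C * |t|)) fun n => ?_
  rw [toralMap_add, hA', Real.norm_eq_abs, abs_mul, abs_mul]
  calc _ ≤ |μ n| * (C * |b' n * t|) := by gcongr; exact hC _ _
    _ = _ := by rw [abs_mul]; ring

theorem continuous_tsum_deriv (hp : HasContDerivAlong p v D)
    (hs : Summable fun n => |μ n * b' n|) :
    Continuous fun x => ∑' n, μ n * b' n * D (toralMap (A' n) x) := by
  obtain ⟨C, hC0, hC⟩ := exists_norm_le_of_continuous hp.1
  refine continuous_tsum (fun n => continuous_const.mul (hp.1.comp (continuous_toralMap _)))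
    (hs.mul_right C) fun n x => ?_
  rw [Real.norm_eq_abs, abs_mul]
  gcongr
  exact hC _

theorem hasDerivAt_tsum_increments (hp : HasContDerivAlong p v D)
    (hA' : ∀ n t, toralMap (A' n) (torusProj (t • v)) = torusProj ((b' n * t) • v))
    (hs : Summable fun n => |μ n * b' n|) (x : UnitAddTorus (Fin k)) (t : ℝ) :
    HasDerivAt (fun t => ∑' n, μ n * (p (toralMap (A' n) (x + torusProj (t • v))) -
        p (toralMap (A' n) x)))
      (∑' n, μ n * b' n * D (toralMap (A' n) (x + torusProj (t • v)))) t := by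
  obtain ⟨C, hC0, hC⟩ := exists_norm_le_of_continuous hp.1
  refine hasDerivAt_tsum (g' := fun n t => μ n * b' n * D (toralMap (A' n) (x + torusProj (t • v))))
    (hs.mul_right C) (fun n t => ?_) (fun n t => ?_) (summable_increments hp hA' hs x 0) t
  · simp only [toralMap_add, hA']
    have h1 := (hp.2 (toralMap (A' n) x) (b' n * t)).comp t ((hasDerivAt_id t).const_mul (b' n))
    convert! (h1.sub_const (p (toralMap (A' n) x))).const_mul (μ n) using 1
    ring
  · rw [Real.norm_eq_abs, abs_mul]
    gcongr
    exact hC _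

theorem exists_abs_tsum_increments_le (hp : HasContDerivAlong p v D)
    (hA' : ∀ n t, toralMap (A' n) (torusProj (t • v)) = torusProj ((b' n * t) • v))
    (hs : Summable fun n => |μ n * b' n|) :
    ∃ C, 0 < C ∧ ∀ x t, |∑' n, μ n * (p (toralMap (A' n) (x + torusProj (t • v))) -
        p (toralMap (A' n) x))| ≤ C * |t| := by
  obtain ⟨C, hC0, hC⟩ := exists_norm_le_of_continuous
    (continuous_tsum_deriv (A' := A') hp hs)
  refine ⟨C, hC0, fun x t => ?_⟩
  simpa [torusProj_zero] using abs_sub_le_of_hasDerivAt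
    (hasDerivAt_tsum_increments hp hA' hs x) (fun t => hC _) 0 t

end Series

/-! ### The function φ and its two-sided increment series -/

section SkewPhi

variable {k : ℕ} {A : Matrix.GeneralLinearGroup (Fin k) ℤ} {lam : ℝ}
  {p D : UnitAddTorus (Fin k) → ℝ} {b : ℝ} {v : Fin k → ℝ}

theorem summable_skewPhi (hlam : lam ∈ Set.Ioo 0 1) (hp : Continuous p)
    (x : UnitAddTorus (Fin k)) : Summable fun n : ℕ => lam ^ n * p (toralMap (A⁻¹ ^ n) x) := by
  obtain ⟨C, hC0, hC⟩ := exists_norm_le_of_continuous hp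
  refine Summable.of_norm_bounded ((summable_geometric_of_lt_one hlam.1.le hlam.2).mul_right C)
    fun n => ?_
  rw [norm_mul, norm_pow, Real.norm_of_nonneg hlam.1.le]
  exact mul_le_mul_of_nonneg_left (hC _) (pow_nonneg hlam.1.le _)

theorem continuous_skewPhi (hlam : lam ∈ Set.Ioo 0 1) (hp : Continuous p) :
    Continuous (skewPhi A lam p) := by
  obtain ⟨C, hC0, hC⟩ := exists_norm_le_of_continuous hp
  refine continuous_tsum (fun n => continuous_const.mul (hp.comp (continuous_toralMap _)))
    ((summable_geometric_of_lt_one hlam.1.le hlam.2).mul_right C) fun n x => ?_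
  rw [norm_mul, norm_pow, Real.norm_of_nonneg hlam.1.le]
  exact mul_le_mul_of_nonneg_left (hC _) (pow_nonneg hlam.1.le _)

theorem hasSum_skewPhi_sub (hlam : lam ∈ Set.Ioo 0 1) (hp : Continuous p)
    (x y : UnitAddTorus (Fin k)) :
    HasSum (fun n : ℕ => lam ^ n * (p (toralMap (A⁻¹ ^ n) y) - p (toralMap (A⁻¹ ^ n) x)))
      (skewPhi A lam p y - skewPhi A lam p x) := by
  simp only [mul_sub]
  exact (summable_skewPhi hlam hp y).hasSum.sub (summable_skewPhi hlam hp x).hasSum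

theorem exists_hasContDerivAlong_skewPhi_of_lt (hlam : lam ∈ Set.Ioo 0 1)
    (hpc : Continuous p) (hp : HasContDerivAlong p v D) (hb : b ≠ 0)
    (hA : ((A : Matrix (Fin k) (Fin k) ℤ).map (Int.cast : ℤ → ℝ)).mulVec v = b • v)
    (hlb : lam < |b|) : ∃ D', HasContDerivAlong (skewPhi A lam p) v D' := by
  have hA' : ∀ (n : ℕ) (t : ℝ), toralMap (A⁻¹ ^ n) (torusProj (t • v)) =
      torusProj ((b⁻¹ ^ n * t) • v) := fun n t => by
    have := toralMap_zpow_torusProj hb hA (-(n : ℤ)) t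
    rwa [zpow_neg, zpow_natCast, ← inv_pow, zpow_neg, zpow_natCast, ← inv_pow] at this
  have hs : Summable fun n : ℕ => |lam ^ n * b⁻¹ ^ n| := by
    have : ∀ n : ℕ, |lam ^ n * b⁻¹ ^ n| = (lam / |b|) ^ n := fun n => by
      rw [← mul_pow, abs_pow, abs_mul, abs_inv, abs_of_pos hlam.1, div_eq_mul_inv]
    simp only [this]
    exact summable_geometric_of_lt_one (by have := hlam.1; positivity)
      ((div_lt_one (abs_pos.2 hb)).2 hlb)
  refine ⟨_, continuous_tsum_deriv (A' := fun n => A⁻¹ ^ n) hp hs, fun x t => ?_⟩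
  have h1 := (hasDerivAt_tsum_increments hp hA' hs x t).const_add (skewPhi A lam p x)
  refine h1.congr_of_eventuallyEq (Eventually.of_forall fun s => ?_)
  simp only []
  rw [(hasSum_skewPhi_sub hlam hpc x (x + torusProj (s • v))).tsum_eq]
  ring

/-- The `n`-th term of the two-sided series of increments. -/
def cocycleTerm (A : Matrix.GeneralLinearGroup (Fin k) ℤ) (lam : ℝ)
    (p : UnitAddTorus (Fin k) → ℝ) (v : Fin k → ℝ) (s : ℝ) (n : ℤ)
    (x : UnitAddTorus (Fin k)) : ℝ :=
  lam ^ n * (p (toralMap (A ^ (-n)) (x + torusProj (s • v))) - p (toralMap (A ^ (-n)) x))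

/-- The two-sided series of increments
`∑_{n ∈ ℤ} λ^n (p (A^{-n} (x + s v)) - p (A^{-n} x))`. -/
def incrementCocycle (A : Matrix.GeneralLinearGroup (Fin k) ℤ) (lam : ℝ)
    (p : UnitAddTorus (Fin k) → ℝ) (v : Fin k → ℝ) (s : ℝ) (x : UnitAddTorus (Fin k)) : ℝ :=
  ∑' n : ℤ, cocycleTerm A lam p v s n x

theorem toralMap_pow_succ_torusProj (hb : b ≠ 0)
    (hA : ((A : Matrix (Fin k) (Fin k) ℤ).map (Int.cast : ℤ → ℝ)).mulVec v = b • v)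
    (n : ℕ) (t : ℝ) : toralMap (A ^ (n + 1)) (torusProj (t • v)) =
      torusProj ((b ^ (n + 1) * t) • v) := by
  have := toralMap_zpow_torusProj hb hA ((n + 1 : ℕ) : ℤ) t
  rwa [zpow_natCast, zpow_natCast] at this

theorem summable_inv_pow_mul_pow (hlam : lam ∈ Set.Ioo 0 1) (hbl : |b| < lam) :
    Summable fun n : ℕ => |(lam ^ (n + 1))⁻¹ * b ^ (n + 1)| := by
  have : ∀ n : ℕ, |(lam ^ (n + 1))⁻¹ * b ^ (n + 1)| = (|b| / lam) ^ (n + 1) := fun n => by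
    rw [← inv_pow, ← mul_pow, abs_pow, abs_mul, abs_inv, abs_of_pos hlam.1, div_eq_mul_inv,
      mul_comm]
  simp only [this]
  exact (summable_nat_add_iff 1).2 (summable_geometric_of_lt_one
    (div_nonneg (abs_nonneg _) hlam.1.le) ((div_lt_one hlam.1).2 hbl))

/-- The part of the two-sided series of increments with negative indices. -/
def cocycleRemainder (A : Matrix.GeneralLinearGroup (Fin k) ℤ) (lam : ℝ)
    (p : UnitAddTorus (Fin k) → ℝ) (v : Fin k → ℝ) (s : ℝ) (x : UnitAddTorus (Fin k)) : ℝ :=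
  ∑' n : ℕ, (lam ^ (n + 1))⁻¹ * (p (toralMap (A ^ (n + 1)) (x + torusProj (s • v))) -
    p (toralMap (A ^ (n + 1)) x))

/-- Splitting ℤ at zero separates the increment of φ from a term that is Lipschitz in s. -/
theorem incrementCocycle_eq (hlam : lam ∈ Set.Ioo 0 1) (hbl : |b| < lam)
    (hpc : Continuous p) (hp : HasContDerivAlong p v D) (hb : b ≠ 0)
    (hA : ((A : Matrix (Fin k) (Fin k) ℤ).map (Int.cast : ℤ → ℝ)).mulVec v = b • v)
    (s : ℝ) (x : UnitAddTorus (Fin k)) :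
    incrementCocycle A lam p v s x =
      (skewPhi A lam p (x + torusProj (s • v)) - skewPhi A lam p x) +
        cocycleRemainder A lam p v s x := by
  refine (HasSum.of_nat_of_neg_add_one ?_ ?_).tsum_eq
  · convert! hasSum_skewPhi_sub (A := A) hlam hpc x (x + torusProj (s • v)) using 2 with n
    simp [cocycleTerm]
  · exact (summable_increments hp (toralMap_pow_succ_torusProj hb hA)
      (summable_inv_pow_mul_pow hlam hbl) x s).hasSum

theorem exists_abs_cocycleRemainder_le (hlam : lam ∈ Set.Ioo 0 1) (hbl : |b| < lam)
    (hp : HasContDerivAlong p v D) (hb : b ≠ 0)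
    (hA : ((A : Matrix (Fin k) (Fin k) ℤ).map (Int.cast : ℤ → ℝ)).mulVec v = b • v) :
    ∃ C, 0 < C ∧ ∀ x s, |cocycleRemainder A lam p v s x| ≤ C * |s| :=
  exists_abs_tsum_increments_le hp (toralMap_pow_succ_torusProj hb hA)
    (summable_inv_pow_mul_pow hlam hbl)

theorem exists_hasContDerivAlong_skewPhi_of_incrementCocycle_eq_zero (hlam : lam ∈ Set.Ioo 0 1)
    (hbl : |b| < lam) (hpc : Continuous p) (hp : HasContDerivAlong p v D) (hb : b ≠ 0)
    (hA : ((A : Matrix (Fin k) (Fin k) ℤ).map (Int.cast : ℤ → ℝ)).mulVec v = b • v)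
    (h0 : ∀ s x, incrementCocycle A lam p v s x = 0) :
    ∃ D', HasContDerivAlong (skewPhi A lam p) v D' := by
  refine ⟨_, (continuous_tsum_deriv (A' := fun n => A ^ (n + 1)) hp
    (summable_inv_pow_mul_pow hlam hbl)).neg, fun x t => ?_⟩
  have h1 := (hasDerivAt_tsum_increments hp (toralMap_pow_succ_torusProj hb hA)
    (summable_inv_pow_mul_pow hlam hbl) x t).const_sub (skewPhi A lam p x)
  refine h1.congr_of_eventuallyEq (Eventually.of_forall fun s => ?_)
  have h2 := incrementCocycle_eq hlam hbl hpc hp hb hA s x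
  rw [h0, cocycleRemainder] at h2
  simp only []
  linarith

/-- Boundedness of p controls n ≥ 0, with ratio λ; its Lipschitz bound along `v` controls n < 0,
with ratio |b|/λ. -/
theorem exists_summable_cocycleTerm_bound (hlam : lam ∈ Set.Ioo 0 1) (hbl : |b| < lam)
    (hpc : Continuous p) (hp : HasContDerivAlong p v D) (hb : b ≠ 0)
    (hA : ((A : Matrix (Fin k) (Fin k) ℤ).map (Int.cast : ℤ → ℝ)).mulVec v = b • v) (s : ℝ) :
    ∃ u : ℤ → ℝ, Summable u ∧ ∀ n x, |cocycleTerm A lam p v s n x| ≤ u n := by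
  obtain ⟨M, hM0, hM⟩ := exists_norm_le_of_continuous hpc
  obtain ⟨C, hC0, hC⟩ := hp.exists_abs_sub_le
  let u : ℤ → ℝ := fun n => match n with
    | Int.ofNat n => lam ^ n * (M + M)
    | Int.negSucc n => |(lam ^ (n + 1))⁻¹ * b ^ (n + 1)| * (C * |s|)
  refine ⟨u, Summable.of_nat_of_neg_add_one ?_ ?_, fun n x => ?_⟩
  · exact (summable_geometric_of_lt_one hlam.1.le hlam.2).mul_right (M + M)
  · have h1 : ∀ n : ℕ, u (-((n : ℤ) + 1)) = |(lam ^ (n + 1))⁻¹ * b ^ (n + 1)| * (C * |s|) :=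
      fun n => by rw [← Int.negSucc_eq]
    simp only [h1]
    exact (summable_inv_pow_mul_pow hlam hbl).mul_right _
  · cases n with
    | ofNat n =>
      simp only [cocycleTerm, u, Int.ofNat_eq_natCast, zpow_natCast]
      rw [abs_mul, abs_of_pos (pow_pos hlam.1 n)]
      have := pow_pos hlam.1 n
      gcongr
      exact (abs_sub _ _).trans (add_le_add (hM _) (hM _))
    | negSucc n =>
      have h1 : A ^ (-(Int.negSucc n)) = A ^ (n + 1) := by
        rw [Int.neg_negSucc]; exact_mod_cast zpow_natCast A (n + 1)
      simp only [cocycleTerm, u, h1, zpow_negSucc]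
      rw [toralMap_add, toralMap_pow_succ_torusProj hb hA, abs_mul, abs_mul]
      calc _ ≤ |(lam ^ (n + 1))⁻¹| * (C * |b ^ (n + 1) * s|) := by gcongr; exact hC _ _
        _ = _ := by rw [abs_mul]; ring

theorem continuous_cocycleTerm (hpc : Continuous p) (s : ℝ) (n : ℤ) :
    Continuous (cocycleTerm A lam p v s n) := by
  have := continuous_toralMap (A ^ (-n))
  unfold cocycleTerm
  fun_prop

theorem continuous_incrementCocycle (hlam : lam ∈ Set.Ioo 0 1) (hbl : |b| < lam)
    (hpc : Continuous p) (hp : HasContDerivAlong p v D) (hb : b ≠ 0)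
    (hA : ((A : Matrix (Fin k) (Fin k) ℤ).map (Int.cast : ℤ → ℝ)).mulVec v = b • v) (s : ℝ) :
    Continuous (incrementCocycle A lam p v s) := by
  obtain ⟨u, hu, hbd⟩ := exists_summable_cocycleTerm_bound hlam hbl hpc hp hb hA s
  exact continuous_tsum (fun n => continuous_cocycleTerm hpc s n) hu hbd

/-- Applying A^n only shifts the summation index, which is why the series must run over all of ℤ. -/
theorem incrementCocycle_zpow (hlam : 0 < lam) (hb : b ≠ 0)
    (hA : ((A : Matrix (Fin k) (Fin k) ℤ).map (Int.cast : ℤ → ℝ)).mulVec v = b • v)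
    (n : ℤ) (s : ℝ) (x : UnitAddTorus (Fin k)) :
    incrementCocycle A lam p v (b ^ n * s) (toralMap (A ^ n) x) =
      lam ^ n * incrementCocycle A lam p v s x := by
  unfold incrementCocycle
  rw [← tsum_mul_left, ← (Equiv.addRight n).tsum_eq]
  refine tsum_congr fun m => ?_
  simp only [cocycleTerm, Equiv.coe_addRight]
  rw [← toralMap_zpow_torusProj hb hA, ← toralMap_add, ← toralMap_mul, ← toralMap_mul, ← zpow_add,
    zpow_add₀ hlam.ne', show -(m + n) + n = -m by ring]
  ring

/-- Along the line, the n-th term is λ^n times the difference between q_n(b^{-n}(t+s)) and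
q_n(b^{-n}t). Rescaling moves the frequency from σ b^n to σ, and translation by s contributes
e^{iσs}. -/
theorem hasMean_incrementCocycle (hlam : lam ∈ Set.Ioo 0 1) (hbl : |b| < lam)
    (hpc : Continuous p) (hp : HasContDerivAlong p v D) (hb : b ≠ 0)
    (hA : ((A : Matrix (Fin k) (Fin k) ℤ).map (Int.cast : ℤ → ℝ)).mulVec v = b • v)
    (s σ : ℝ) (x : UnitAddTorus (Fin k)) :
    HasMean (fun t => (incrementCocycle A lam p v s (x + torusProj (t • v)) : ℂ)) σ
      ((Complex.exp (Complex.I * σ * s) - 1) * gFourierCoeff A lam p b v x σ) := by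
  obtain ⟨M, hM0, hM⟩ := exists_norm_le_of_continuous hpc
  obtain ⟨u, hu, hbd⟩ := exists_summable_cocycleTerm_bound hlam hbl hpc hp hb hA s
  let pC : C(UnitAddTorus (Fin k), ℂ) := ⟨fun x => (p x : ℂ), Complex.continuous_ofReal.comp hpc⟩
  have hterm : ∀ n : ℤ, HasMean (fun t => (cocycleTerm A lam p v s n (x + torusProj (t • v)) : ℂ)) σ
      ((Complex.exp (Complex.I * σ * s) - 1) * ((lam : ℂ) ^ n *
        apFourierCoeff (torusSlice p v (toralMap (A ^ (-n)) x)) (σ * b ^ n))) := by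
    intro n
    set q : ℝ → ℂ := fun t => pC (toralMap (A ^ (-n)) x + torusProj (t • v)) with hq
    obtain ⟨L, hL⟩ := exists_hasMean_slice pC v (toralMap (A ^ (-n)) x) (σ * b ^ n)
    have hL' : apFourierCoeff (torusSlice p v (toralMap (A ^ (-n)) x)) (σ * b ^ n) = L :=
      HasMean.apFourierCoeff_eq hL
    have hbn : b ^ (-n) ≠ 0 := zpow_ne_zero _ hb
    have h1 := HasMean.comp_mul hL hbn
    rw [show b ^ (-n) * (σ * b ^ n) = σ by rw [zpow_neg]; field_simp] at h1
    have hc : Continuous fun t => q (b ^ (-n) * t) :=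
      (continuous_slice pC.continuous v _).comp (continuous_const.mul continuous_id)
    have hcs : Continuous fun t => q (b ^ (-n) * (t + s)) :=
      hc.comp (continuous_id.add continuous_const)
    have h2 := HasMean.comp_add hc (M := M) (fun t => by
      simp only [hq, pC, ContinuousMap.coe_mk, Complex.norm_real]; exact hM _) h1 s
    have hcn : Continuous fun t => -1 * q (b ^ (-n) * t) := continuous_const.mul hc
    have h3 := (h2.add hcs hcn (h1.const_mul (-1))).const_mul ((lam : ℂ) ^ n)
    rw [hL']
    convert! h3 using 1
    · funext t
      simp only [cocycleTerm, hq, pC, ContinuousMap.coe_mk, toralMap_add,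
        toralMap_zpow_torusProj hb hA, add_assoc]
      rw [← torusProj_add, ← add_smul, ← mul_add]
      push_cast
      ring
    · ring
  have h := hasMean_tsum (fun n => Complex.continuous_ofReal.comp
    (continuous_slice (continuous_cocycleTerm hpc s n) v x)) hu
    (fun n t => by
      simp only [Function.comp_apply, Complex.norm_real]; exact hbd n _) hterm
  rw [tsum_mul_left] at h
  convert! h using 1
  funext t
  simp only [incrementCocycle, Complex.ofReal_tsum, Function.comp_apply]

theorem hasNonzeroCoeff_iff (hlam : lam ∈ Set.Ioo 0 1) (hbl : |b| < lam)
    (hpc : Continuous p) (hp : HasContDerivAlong p v D) (hb : b ≠ 0)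
    (hA : ((A : Matrix (Fin k) (Fin k) ℤ).map (Int.cast : ℤ → ℝ)).mulVec v = b • v) :
    HasNonzeroCoeff A lam p b v ↔ ∃ s x, incrementCocycle A lam p v s x ≠ 0 := by
  constructor
  · rintro ⟨x, σ, hσ, hg⟩
    by_contra! h
    -- The choice s = π/σ makes the factor e^{iσs} - 1 equal to -2.
    have h1 := hasMean_incrementCocycle hlam hbl hpc hp hb hA (Real.pi / σ) σ x
    simp only [h, Complex.ofReal_zero] at h1
    have h2 := (hasMean_zero σ).unique h1
    have hσC : (σ : ℂ) ≠ 0 := by exact_mod_cast hσ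
    rw [show Complex.I * (σ : ℂ) * ((Real.pi / σ : ℝ) : ℂ) = Real.pi * Complex.I by
      push_cast; field_simp, Complex.exp_pi_mul_I] at h2
    exact mul_ne_zero (by norm_num) hg h2.symm
  · rintro ⟨s, x, hsx⟩
    by_contra h
    apply hsx
    let F : C(UnitAddTorus (Fin k), ℂ) := ⟨fun x => (incrementCocycle A lam p v s x : ℂ),
      Complex.continuous_ofReal.comp (continuous_incrementCocycle hlam hbl hpc hp hb hA s)⟩
    have hF : F = 0 := by
      refine eq_zero_of_hasMean_zero F v fun x σ => ?_
      have h1 := hasMean_incrementCocycle hlam hbl hpc hp hb hA s σ x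
      have h2 : (Complex.exp (Complex.I * σ * s) - 1) * gFourierCoeff A lam p b v x σ = 0 := by
        by_cases hσ : σ = 0
        · simp [hσ]
        · rw [mul_eq_zero]
          exact Or.inr (by by_contra hg; exact h ⟨x, σ, hσ, hg⟩)
      rwa [h2] at h1
    have := DFunLike.congr_fun hF x
    simpa [F] using this

end SkewPhi

/-! ### Hölder regularity along eigendirections -/

/-- `f` is `α`-Hölder in the direction `v`, uniformly in the base point. -/
def IsHolderAlong {k : ℕ} (f : UnitAddTorus (Fin k) → ℝ) (v : Fin k → ℝ) (α : ℝ) : Prop :=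
  ∃ C, 0 < C ∧ ∀ x (t : ℝ), |f (x + torusProj (t • v)) - f x| ≤ C * |t| ^ α

theorem IsHolderAlong.mono {k : ℕ} {f : UnitAddTorus (Fin k) → ℝ} {v : Fin k → ℝ} {α β : ℝ}
    (h : IsHolderAlong f v β) (hf : Continuous f) (h0 : 0 < α) (hαβ : α ≤ β) :
    IsHolderAlong f v α := by
  obtain ⟨C, hC0, hC⟩ := h
  obtain ⟨M, hM0, hM⟩ := exists_norm_le_of_continuous hf
  refine ⟨C + (M + M), by positivity, fun x t => ?_⟩
  have ht : 0 ≤ |t| ^ α := Real.rpow_nonneg (abs_nonneg t) α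
  rcases le_total |t| 1 with h | h
  · have h2 : |t| ^ β ≤ |t| ^ α := by
      rcases (abs_nonneg t).eq_or_lt with h3 | h3
      · rw [← h3, Real.zero_rpow h0.ne', Real.zero_rpow (by linarith)]
      · exact Real.rpow_le_rpow_of_exponent_ge h3 h hαβ
    calc _ ≤ C * |t| ^ β := hC x t
      _ ≤ C * |t| ^ α := by gcongr
      _ ≤ _ := by nlinarith
  · have h2 : 1 ≤ |t| ^ α := Real.one_le_rpow h h0.le
    calc _ ≤ M + M := (abs_sub _ _).trans (add_le_add (hM _) (hM _))
      _ ≤ _ := by nlinarith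

theorem HasContDerivAlong.isHolderAlong {k : ℕ} {f D : UnitAddTorus (Fin k) → ℝ}
    {v : Fin k → ℝ} (h : HasContDerivAlong f v D) (hf : Continuous f) {α : ℝ} (h0 : 0 < α)
    (h1 : α ≤ 1) : IsHolderAlong f v α := by
  obtain ⟨C, hC0, hC⟩ := h.exists_abs_sub_le
  exact IsHolderAlong.mono ⟨C, hC0, fun x t => by rw [Real.rpow_one]; exact hC x t⟩ hf h0 h1

theorem abs_rpow_log_div_log {b lam : ℝ} (hb : 0 < |b|) (hb1 : |b| < 1) (hlam : 0 < lam) :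
    |b| ^ (Real.log lam / Real.log |b|) = lam := by
  rw [Real.rpow_def_of_pos hb, mul_div_cancel₀ _ (Real.log_neg hb hb1).ne, Real.exp_log hlam]

theorem isHolderAlong_skewPhi {k : ℕ} {A : Matrix.GeneralLinearGroup (Fin k) ℤ} {lam : ℝ}
    {p D : UnitAddTorus (Fin k) → ℝ} {b : ℝ} {v : Fin k → ℝ}
    (hlam : lam ∈ Set.Ioo 0 1) (hbl : |b| < lam)
    (hpc : Continuous p) (hp : HasContDerivAlong p v D) (hb : b ≠ 0)
    (hA : ((A : Matrix (Fin k) (Fin k) ℤ).map (Int.cast : ℤ → ℝ)).mulVec v = b • v) :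
    IsHolderAlong (skewPhi A lam p) v (Real.log lam / Real.log |b|) := by
  obtain ⟨C, hC0, hC⟩ := exists_abs_cocycleRemainder_le hlam hbl hp hb hA
  obtain ⟨M, hM0, hM⟩ := exists_norm_le_of_continuous (continuous_skewPhi (A := A) hlam hpc)
  have hb0 : 0 < |b| := abs_pos.2 hb
  have hb1 : |b| < 1 := hbl.trans hlam.2
  set α := Real.log lam / Real.log |b| with hα
  have hbα : |b| ^ α = lam := abs_rpow_log_div_log hb0 hb1 hlam.1
  have hα0 : 0 < α := div_pos_of_neg_of_neg (Real.log_neg hlam.1 hlam.2) (Real.log_neg hb0 hb1)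
  have hα1 : α ≤ 1 := by
    rw [hα, div_le_one_of_neg (Real.log_neg hb0 hb1)]
    exact Real.log_le_log hb0 hbl.le
  -- The first term comes from the rescaled increment, the second from the Lipschitz remainder, and
  -- the last from the trivial bound when |t| ≥ 1.
  refine ⟨(M + M + C) / lam + C + (M + M), by have := hlam.1; positivity, fun x t => ?_⟩
  have hlam0 := hlam.1
  have ht : 0 ≤ |t| ^ α := Real.rpow_nonneg (abs_nonneg t) α
  have hφ : ∀ x (t : ℝ), |skewPhi A lam p (x + torusProj (t • v)) - skewPhi A lam p x| ≤ M + M :=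
    fun x t => (abs_sub _ _).trans (add_le_add (hM _) (hM _))
  rcases le_total |t| 1 with h | h
  · rcases (abs_nonneg t).eq_or_lt with h3 | h3
    · rw [abs_eq_zero.1 h3.symm]
      simp only [zero_smul, torusProj_zero, add_zero, sub_self, abs_zero]
      rw [← h3] at ht
      positivity
    · obtain ⟨n, hn1, hn2⟩ := exists_nat_pow_near_of_lt_one h3 h hb0 hb1
      have h2 : |t| ≤ |t| ^ α := by
        simpa using Real.rpow_le_rpow_of_exponent_ge h3 h hα1
      have hbn : b ^ n ≠ 0 := pow_ne_zero _ hb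
      have hs : |t / b ^ n| ≤ 1 := by
        rw [abs_div, abs_pow]; exact (div_le_one (by positivity)).2 hn2
      -- With |b|^{n+1} < |t| ≤ |b|^n, the increment at scale t is λ^n times one at scale t/b^n,
      -- which has modulus at most 1.
      have h4 := incrementCocycle_zpow (p := p) (lam := lam) hlam.1 hb hA n (t / b ^ n)
        (toralMap (A ^ (-(n : ℤ))) x)
      rw [← toralMap_mul, ← zpow_add, add_neg_cancel, zpow_zero, toralMap_one, zpow_natCast,
        zpow_natCast, mul_div_cancel₀ _ hbn, incrementCocycle_eq hlam hbl hpc hp hb hA,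
        incrementCocycle_eq hlam hbl hpc hp hb hA] at h4
      have h5 : lam ^ n ≤ |t| ^ α / lam := by
        rw [le_div_iff₀ hlam.1, ← pow_succ, ← hbα, ← Real.rpow_natCast, ← Real.rpow_mul hb0.le,
          mul_comm, Real.rpow_mul hb0.le, Real.rpow_natCast]
        exact Real.rpow_le_rpow (by positivity) hn1.le hα0.le
      rw [eq_comm, ← sub_eq_iff_eq_add] at h4
      rw [← h4]
      refine (abs_sub _ _).trans ?_
      rw [abs_mul, abs_of_pos (pow_pos hlam.1 n)]
      calc _ ≤ |t| ^ α / lam * ((M + M) + C * 1) + C * |t| := by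
            refine add_le_add (mul_le_mul h5 ((abs_add_le _ _).trans (add_le_add (hφ _ _)
              ((hC _ _).trans (by gcongr)))) (abs_nonneg _) (by positivity)) (hC _ _)
        _ ≤ |t| ^ α / lam * ((M + M) + C * 1) + C * |t| ^ α + (M + M) * |t| ^ α := by
            have : 0 ≤ (M + M) * |t| ^ α := by positivity
            nlinarith
        _ = _ := by ring
  · have h2 : 1 ≤ |t| ^ α := Real.one_le_rpow h hα0.le
    have h3 : 0 ≤ (M + M + C) / lam + C := by positivity
    calc _ ≤ M + M := hφ x t
      _ ≤ _ := by nlinarith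

/-- Move from x to x + w one basis coordinate at a time; each coordinate is bounded linearly by ‖w‖.
-/
theorem exists_holder_of_isHolderAlong_basis {k : ℕ} {f : UnitAddTorus (Fin k) → ℝ} {α : ℝ}
    (hα : 0 < α) (e : Module.Basis (Fin k) ℝ (Fin k → ℝ)) (h : ∀ j, IsHolderAlong f (e j) α) :
    ∃ C, 0 < C ∧ ∀ x w, |f (x + torusProj w) - f x| ≤ C * ‖w‖ ^ α := by
  choose C hC0 hC using h
  have hsum : ∀ (s : Finset (Fin k)) (c : Fin k → ℝ) x,
      |f (x + torusProj (∑ j ∈ s, c j • e j)) - f x| ≤ ∑ j ∈ s, C j * |c j| ^ α := by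
    intro s c
    induction s using Finset.induction_on with
    | empty => simp [torusProj_zero]
    | insert j s hj ih =>
      intro x
      rw [Finset.sum_insert hj, Finset.sum_insert hj, torusProj_add, ← add_assoc]
      calc _ = |(f (x + torusProj (c j • e j) + torusProj (∑ j ∈ s, c j • e j)) -
            f (x + torusProj (c j • e j))) + (f (x + torusProj (c j • e j)) - f x)| := by
              congr 1; ring
        _ ≤ _ := by
          rw [add_comm (C j * _)]
          exact (abs_add_le _ _).trans (add_le_add (ih _) (hC _ _ _))
  let L : Fin k → ((Fin k → ℝ) →L[ℝ] ℝ) := fun j => LinearMap.toContinuousLinearMap (e.coord j)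
  refine ⟨∑ j, C j * ‖L j‖ ^ α + 1, ?_, fun x w => ?_⟩
  · have : 0 ≤ ∑ j, C j * ‖L j‖ ^ α := Finset.sum_nonneg fun j _ =>
      mul_nonneg (hC0 j).le (Real.rpow_nonneg (norm_nonneg _) _)
    linarith
  · have h1 := hsum Finset.univ (fun j => e.repr w j) x
    rw [e.sum_repr w] at h1
    refine h1.trans ?_
    rw [add_mul, one_mul, Finset.sum_mul]
    refine le_add_of_le_of_nonneg (Finset.sum_le_sum fun j _ => ?_)
      (Real.rpow_nonneg (norm_nonneg _) _)
    rw [mul_assoc, ← Real.mul_rpow (norm_nonneg _) (norm_nonneg _)]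
    refine mul_le_mul_of_nonneg_left (Real.rpow_le_rpow (abs_nonneg _) ?_ hα.le) (hC0 j).le
    exact (L j).le_opNorm w

/-- Eigenvectors of a matrix whose eigenvalues have distinct absolute values
form a basis. -/
theorem exists_basis_of_eigenvectors {k : ℕ} (hk : 0 < k) {M : Matrix (Fin k) (Fin k) ℝ}
    {B : Fin k → ℝ} {v : Fin k → Fin k → ℝ} (hv : ∀ i, v i ≠ 0)
    (hM : ∀ i, M.mulVec (v i) = B i • v i) (hB : StrictMono fun i => |B i|) :
    ∃ e : Module.Basis (Fin k) ℝ (Fin k → ℝ), ∀ i, e i = v i := by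
  have hinj : Function.Injective B := fun i j hij => hB.injective (by simp [hij])
  have hli : LinearIndependent ℝ v :=
    Module.End.eigenvectors_linearIndependent' (Matrix.toLin' M) B hinj v fun i =>
      ⟨Module.End.mem_eigenspace_iff.2 (by rw [Matrix.toLin'_apply, hM]), hv i⟩
  have : Nonempty (Fin k) := ⟨⟨0, hk⟩⟩
  exact ⟨basisOfLinearIndependentOfCardEqFinrank hli (by simp), fun i => by simp⟩

/-! ### Covering numbers and box dimension -/

theorem diamCoveringNumber_le_card {M : Type*} [PseudoMetricSpace M] {X : Set M} {δ : ℝ}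
    {ι : Type*} [Fintype ι] (U : ι → Set M) (hU : ∀ i, Metric.ediam (U i) ≤ ENNReal.ofReal δ)
    (hX : X ⊆ ⋃ i, U i) : diamCoveringNumber X δ ≤ Fintype.card ι := by
  refine Nat.sInf_le ⟨fun i => U ((Fintype.equivFin ι).symm i), fun i => hU _, fun x hx => ?_⟩
  obtain ⟨i, hi⟩ := Set.mem_iUnion.1 (hX hx)
  exact Set.mem_iUnion.2 ⟨Fintype.equivFin ι i, by simpa using hi⟩

/-- Total boundedness makes the set of admissible cardinalities nonempty; otherwise `sInf` would
take the default value 0. -/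
theorem exists_cover_diamCoveringNumber {M : Type*} [PseudoMetricSpace M] {X : Set M}
    (hX : TotallyBounded X) {δ : ℝ} (hδ : 0 < δ) :
    ∃ U : Fin (diamCoveringNumber X δ) → Set M,
      (∀ i, Metric.ediam (U i) ≤ ENNReal.ofReal δ) ∧ X ⊆ ⋃ i, U i := by
  have hne : {n : ℕ | ∃ U : Fin n → Set M,
      (∀ i, Metric.ediam (U i) ≤ ENNReal.ofReal δ) ∧ X ⊆ ⋃ i, U i}.Nonempty := by
    obtain ⟨t, ht, hXt⟩ := Metric.totallyBounded_iff.1 hX (δ / 2) (by positivity)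
    have := ht.fintype
    refine ⟨Fintype.card t, fun i => Metric.ball ((Fintype.equivFin t).symm i) (δ / 2),
      fun i => Metric.ediam_le fun x hx y hy => ?_, fun x hx => ?_⟩
    · rw [edist_dist]
      refine ENNReal.ofReal_le_ofReal ?_
      have h1 := dist_triangle_right x y ((Fintype.equivFin t).symm i : M)
      rw [Metric.mem_ball] at hx hy
      linarith
    · obtain ⟨y, hy, hxy⟩ := Set.mem_iUnion₂.1 (hXt hx)
      exact Set.mem_iUnion.2 ⟨Fintype.equivFin t ⟨y, hy⟩, by simpa using hxy⟩
  exact Nat.sInf_mem hne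

/-- Two-sided power bounds on the covering numbers determine the box dimension. -/
theorem hasBoxDim_of_bounds {M : Type*} [PseudoMetricSpace M] {X : Set M} {d c C δ₀ : ℝ}
    (hne : X.Nonempty) (hX : TotallyBounded X) (hc : 0 < c) (hC : 0 < C) (hδ₀ : 0 < δ₀)
    (hlow : ∀ δ, 0 < δ → δ < δ₀ → c * δ ^ (-d) ≤ diamCoveringNumber X δ)
    (hup : ∀ δ, 0 < δ → δ < δ₀ → diamCoveringNumber X δ ≤ C * δ ^ (-d)) : HasBoxDim X d := by
  have hlog : Tendsto (fun δ : ℝ => -Real.log δ) (𝓝[>] 0) atTop :=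
    tendsto_neg_atBot_atTop.comp Real.tendsto_log_nhdsGT_zero
  have hlim : ∀ a : ℝ, Tendsto (fun δ : ℝ => a / (-Real.log δ) + d) (𝓝[>] 0) (𝓝 d) := fun a => by
    simpa using (hlog.const_div_atTop a).add_const d
  have hdiv : ∀ a δ : ℝ, 0 < a → 0 < δ → 0 < -Real.log δ →
      Real.log (a * δ ^ (-d)) / (-Real.log δ) = Real.log a / (-Real.log δ) + d := by
    intro a δ ha hδ hl
    rw [Real.log_mul ha.ne' (Real.rpow_pos_of_pos hδ _).ne', Real.log_rpow hδ, add_div,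
      show -d * Real.log δ = d * (-Real.log δ) by ring, mul_div_cancel_right₀ _ hl.ne']
  have hev : ∀ᶠ δ : ℝ in 𝓝[>] 0, 0 < δ ∧ δ < δ₀ ∧ 0 < -Real.log δ := by
    filter_upwards [self_mem_nhdsWithin, nhdsWithin_le_nhds (Iio_mem_nhds hδ₀),
      hlog.eventually_gt_atTop 0] with δ h1 h2 h3 using ⟨h1, h2, h3⟩
  have ht : Tendsto (fun δ : ℝ => Real.log (diamCoveringNumber X δ) / (-Real.log δ))
      (𝓝[>] 0) (𝓝 d) := by
    refine tendsto_of_tendsto_of_tendsto_of_le_of_le' (hlim (Real.log c)) (hlim (Real.log C)) ?_ ?_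
    · filter_upwards [hev] with δ ⟨h1, h2, h3⟩
      rw [← hdiv c δ hc h1 h3]
      have := mul_pos hc (Real.rpow_pos_of_pos h1 (-d))
      gcongr
      exact hlow δ h1 h2
    · filter_upwards [hev] with δ ⟨h1, h2, h3⟩
      rw [← hdiv C δ hC h1 h3]
      have := (mul_pos hc (Real.rpow_pos_of_pos h1 (-d))).trans_le (hlow δ h1 h2)
      gcongr
      exact hup δ h1 h2
  have ht' : Tendsto (fun δ : ℝ =>
      ((Real.log (diamCoveringNumber X δ) / (-Real.log δ) : ℝ) : EReal))
      (𝓝[>] 0) (𝓝 (d : EReal)) := (continuous_coe_real_ereal.tendsto d).comp ht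
  exact ⟨hne, hX, ht'.liminf_eq, ht'.limsup_eq⟩

/-! ### Covering the graph of a function on the torus -/

section Graph

variable {k : ℕ} {f : UnitAddTorus (Fin k) → ℝ}

theorem torusGraph_nonempty : (torusGraph f).Nonempty := ⟨(0, f 0), rfl⟩

theorem totallyBounded_torusGraph (hf : Continuous f) : TotallyBounded (torusGraph f) := by
  have h : torusGraph f = Set.range fun x => (x, f x) := by
    ext ⟨x, y⟩
    simp [torusGraph, eq_comm]
  rw [h]
  exact (isCompact_range (continuous_id.prodMk hf)).totallyBounded

theorem exists_mem_small_cube {m : ℕ} (hm : 0 < m) (x : UnitAddTorus (Fin k)) :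
    ∃ (j : Fin k → Fin m) (w : Fin k → ℝ), (∀ i, w i ∈ Set.Ico 0 (1 / (m : ℝ))) ∧
      x = torusProj (fun i => (j i : ℝ) / m) + torusProj w := by
  have hmR : (0 : ℝ) < m := by exact_mod_cast hm
  have h1 : ∀ i, ∃ (j : Fin m) (w : ℝ), w ∈ Set.Ico 0 (1 / (m : ℝ)) ∧
      x i = (((j : ℝ) / m : ℝ) : UnitAddCircle) + (w : UnitAddCircle) := by
    intro i
    obtain ⟨y, hy⟩ := QuotientAddGroup.mk_surjective (x i)
    have hfr : ((Int.fract y : ℝ) : UnitAddCircle) = x i := by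
      rw [← hy, Int.fract]
      change ((y - (⌊y⌋ : ℝ) : ℝ) : UnitAddCircle) = (y : UnitAddCircle)
      rw [AddCircle.coe_sub, sub_eq_self]
      exact AddCircle.coe_eq_zero_iff 1 |>.2 ⟨⌊y⌋, by simp⟩
    have hz0 : 0 ≤ Int.fract y * m := mul_nonneg (Int.fract_nonneg y) hmR.le
    refine ⟨⟨⌊Int.fract y * m⌋₊, ?_⟩, Int.fract y - (⌊Int.fract y * m⌋₊ : ℝ) / m, ⟨?_, ?_⟩, ?_⟩
    · rw [Nat.floor_lt hz0]
      nlinarith [Int.fract_lt_one y]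
    · rw [sub_nonneg, div_le_iff₀ hmR]
      exact Nat.floor_le hz0
    · rw [sub_lt_iff_lt_add, ← add_div, lt_div_iff₀ hmR, add_comm]
      exact Nat.lt_floor_add_one _
    · rw [← AddCircle.coe_add, ← hfr]
      congr 1
      ring
  choose j w hw hx using h1
  exact ⟨j, w, hw, funext hx⟩

/-- Over each of about δ^{-k} cubes of side at most δ, the graph lies in a column of height 2Cδ^α,
which is cut into about δ^{α-1} slabs of height δ. -/
theorem diamCoveringNumber_torusGraph_le {α C : ℝ} (hα1 : α ≤ 1) (hC : 0 < C) (hα0 : 0 < α)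
    (h : ∀ x w, |f (x + torusProj w) - f x| ≤ C * ‖w‖ ^ α) {δ : ℝ} (hδ : 0 < δ) (hδ1 : δ < 1) :
    diamCoveringNumber (torusGraph f) δ ≤ (2 ^ k * (2 * C + 1)) * δ ^ (-(k + 1 - α)) := by
  set m := ⌈1 / δ⌉₊ with hm
  have hm0 : 0 < m := Nat.ceil_pos.2 (by positivity)
  have hmR : (0 : ℝ) < m := by exact_mod_cast hm0
  have hmδ : 1 / (m : ℝ) ≤ δ := by
    rw [div_le_comm₀ hmR hδ]
    exact Nat.le_ceil _
  set r := ⌊2 * C * δ ^ (α - 1)⌋₊ + 1 with hr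
  let y : (Fin k → Fin m) → Fin k → ℝ := fun j i => (j i : ℝ) / m
  let base : (Fin k → Fin m) → ℝ := fun j => f (torusProj (y j)) - C * δ ^ α
  let U : (Fin k → Fin m) × Fin r → Set (UnitAddTorus (Fin k) × ℝ) := fun ji =>
    ((fun w => torusProj (y ji.1) + torusProj w) ''
      {w : Fin k → ℝ | ∀ i, w i ∈ Set.Ico 0 (1 / (m : ℝ))}) ×ˢ
      Set.Icc (base ji.1 + ji.2 * δ) (base ji.1 + (ji.2 + 1) * δ)
  have hU : ∀ ji, Metric.ediam (U ji) ≤ ENNReal.ofReal δ := by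
    rintro ⟨j, i⟩
    refine Metric.ediam_le ?_
    rintro ⟨_, z⟩ ⟨⟨w, hw, rfl⟩, hz⟩ ⟨_, z'⟩ ⟨⟨w', hw', rfl⟩, hz'⟩
    rw [edist_dist]
    refine ENNReal.ofReal_le_ofReal (max_le ?_ ?_)
    · have h1 : torusProj w = torusProj w' + torusProj (w - w') := by
        rw [← torusProj_add]; simp
      simp only [dist_add_left, h1, dist_self_add_left]
      refine (norm_torusProj_le _).trans ((pi_norm_le_iff_of_nonneg hδ.le).2 fun i => ?_)
      rw [Pi.sub_apply, Real.norm_eq_abs, abs_le]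
      have := hw i; have := hw' i
      simp only [Set.mem_Ico] at *
      constructor <;> linarith
    · simp only [Set.mem_Icc] at hz hz'
      rw [Real.dist_eq, abs_le]
      constructor <;> linarith
  have hcov : torusGraph f ⊆ ⋃ ji, U ji := by
    rintro ⟨x, z⟩ hz
    obtain ⟨j, w, hw, hx⟩ := exists_mem_small_cube hm0 x
    have hwn : ‖w‖ ≤ δ := (pi_norm_le_iff_of_nonneg hδ.le).2 fun i => by
      rw [Real.norm_of_nonneg (hw i).1]; exact (hw i).2.le.trans hmδ
    have h1 : |z - f (torusProj (y j))| ≤ C * δ ^ α := by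
      have hz' : z = f x := hz
      rw [hz', hx]
      refine (h _ w).trans ?_
      gcongr
    rw [abs_le] at h1
    have hq0 : 0 ≤ (z - base j) / δ := div_nonneg (by simp only [base]; linarith) hδ.le
    have hq : (z - base j) / δ ≤ 2 * C * δ ^ (α - 1) := by
      rw [Real.rpow_sub_one hδ.ne', ← mul_div_assoc]
      gcongr
      simp only [base]; linarith
    refine Set.mem_iUnion.2 ⟨(j, ⟨⌊(z - base j) / δ⌋₊, Nat.lt_succ_of_le (Nat.floor_mono hq)⟩),
      ⟨w, hw, hx.symm⟩, ?_, ?_⟩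
    · have := Nat.floor_le hq0
      rw [le_div_iff₀ hδ] at this
      simp only
      linarith
    · have := (Nat.lt_floor_add_one ((z - base j) / δ)).le
      rw [div_le_iff₀ hδ] at this
      simp only
      linarith
  have hcard := diamCoveringNumber_le_card U hU hcov
  have hcard' : (diamCoveringNumber (torusGraph f) δ : ℝ) ≤ (m : ℝ) ^ k * r := by
    refine (Nat.cast_le.2 hcard).trans (le_of_eq ?_)
    simp
  refine hcard'.trans ?_
  have hone : 1 ≤ δ ^ (α - 1) := Real.one_le_rpow_of_pos_of_le_one_of_nonpos hδ hδ1.le (by linarith)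
  have hm2 : (m : ℝ) ≤ 2 * δ⁻¹ := by
    have h1 := (Nat.ceil_lt_add_one (show 0 ≤ 1 / δ by positivity)).le
    have h2 : 1 ≤ 1 / δ := (one_le_div hδ).2 hδ1.le
    rw [← hm] at h1
    rw [← one_div]
    linarith
  have hr2 : (r : ℝ) ≤ (2 * C + 1) * δ ^ (α - 1) := by
    rw [hr]; push_cast
    have := Nat.floor_le (show 0 ≤ 2 * C * δ ^ (α - 1) by positivity)
    linarith
  calc (m : ℝ) ^ k * r ≤ (2 * δ⁻¹) ^ k * ((2 * C + 1) * δ ^ (α - 1)) := by gcongr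
    _ = _ := by
      rw [show -((k : ℝ) + 1 - α) = (α - 1) - (k : ℕ) by ring, Real.rpow_sub_natCast hδ.ne', mul_pow,
        inv_pow]
      ring

open MeasureTheory in
theorem volume_closedBall_torus_le (x : UnitAddTorus (Fin k)) {r : ℝ} (hr : 0 ≤ r) :
    volume (Metric.closedBall x r) ≤ ENNReal.ofReal ((2 * r) ^ k) := by
  rw [MeasureTheory.volume_pi_closedBall x hr, ENNReal.ofReal_pow (by positivity)]
  calc _ ≤ ∏ _i : Fin k, ENNReal.ofReal (2 * r) := by
        refine Finset.prod_le_prod' fun i _ => ?_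
        rw [AddCircle.volume_closedBall]
        exact ENNReal.ofReal_le_ofReal (min_le_right _ _)
    _ = _ := by simp

open MeasureTheory in
theorem volume_univ_torus : volume (Set.univ : Set (UnitAddTorus (Fin k))) = 1 := by
  rw [volume_pi, ← Set.pi_univ Set.univ, Measure.pi_pi]
  simp

theorem exists_subset_closedBall_of_ediam_le {M : Type*} [PseudoMetricSpace M] [Nonempty M]
    {U : Set M} {δ : ℝ} (hδ : 0 ≤ δ) (hU : Metric.ediam U ≤ ENNReal.ofReal δ) :
    ∃ z : M, U ⊆ Metric.closedBall z δ := by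
  rcases U.eq_empty_or_nonempty with h | ⟨z, hz⟩
  · exact ⟨Classical.arbitrary M, by simp [h]⟩
  · refine ⟨z, fun w hw => ?_⟩
    have := Metric.edist_le_of_ediam_le hw hz hU
    rwa [edist_dist, ENNReal.ofReal_le_ofReal_iff hδ] at this

open MeasureTheory in
-- The cover projects to balls of radius δ that cover the torus, whose total volume is 1.
theorem one_le_diamCoveringNumber_mul (hf : Continuous f) {δ : ℝ} (hδ : 0 < δ) :
    1 ≤ diamCoveringNumber (torusGraph f) δ * (2 * δ) ^ k := by
  obtain ⟨U, hU, hX⟩ := exists_cover_diamCoveringNumber (totallyBounded_torusGraph hf) hδ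
  choose z hz using fun i => exists_subset_closedBall_of_ediam_le hδ.le (hU i)
  have hcov : (Set.univ : Set (UnitAddTorus (Fin k))) ⊆ ⋃ i, Metric.closedBall (z i).1 δ := by
    intro x _
    obtain ⟨i, hi⟩ := Set.mem_iUnion.1 (hX (show (x, f x) ∈ torusGraph f from rfl))
    have h1 : dist (x, f x) (z i) ≤ δ := hz i hi
    exact Set.mem_iUnion.2 ⟨i, (le_max_left _ _).trans h1⟩
  have h1 := (measure_mono hcov).trans (measure_iUnion_fintype_le volume _)
  rw [volume_univ_torus] at h1
  have h2 := h1.trans (Finset.sum_le_sum fun i _ => volume_closedBall_torus_le (z i).1 hδ.le)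
  rw [Finset.sum_const, Finset.card_univ, Fintype.card_fin, nsmul_eq_mul,
    ← ENNReal.ofReal_natCast, ← ENNReal.ofReal_mul (by positivity), ENNReal.one_le_ofReal] at h2
  exact h2

open MeasureTheory in
/-- The volume between a graph and its translate is controlled by the covering numbers. -/
theorem integral_abs_sub_le_diamCoveringNumber_mul (hf : Continuous f) (v : Fin k → ℝ) (h : ℝ)
    {δ : ℝ} (hδ : 0 < δ) :
    ∫ x, |f (x + torusProj (h • v)) - f x| ≤
      diamCoveringNumber (torusGraph f) δ * (2 * (δ + |h| * ‖v‖)) ^ (k + 1) := by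
  obtain ⟨U, hU, hX⟩ := exists_cover_diamCoveringNumber (totallyBounded_torusGraph hf) hδ
  set ρ := δ + |h| * ‖v‖ with hρ
  have hρ0 : 0 ≤ ρ := by positivity
  choose z hz using fun i => exists_subset_closedBall_of_ediam_le hδ.le (hU i)
  set g : UnitAddTorus (Fin k) → ℝ := fun x => f (x + torusProj (h • v)) with hg
  have hgc : Continuous g := hf.comp (continuous_id.add continuous_const)
  have hmin : Continuous fun x => min (f x) (g x) := hf.min hgc
  have hmax : Continuous fun x => max (f x) (g x) := hf.max hgc
  have hcov : regionBetween (fun x => min (f x) (g x)) (fun x => max (f x) (g x)) Set.univ ⊆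
      ⋃ i, Metric.closedBall (z i) ρ := by
    rintro ⟨x, y⟩ ⟨-, hy⟩
    have hline : ContinuousOn (fun t : ℝ => f (x + torusProj (t • v))) (Set.uIcc 0 h) :=
      (continuous_slice hf v x).continuousOn
    -- A height between f(x) and f(x+hv) is attained on the segment from x to x+hv, so (x, y) lies
    -- within |h|‖v‖ of the graph.
    obtain ⟨t, ht, hty⟩ := intermediate_value_uIcc hline
      (show y ∈ Set.uIcc (f (x + torusProj ((0 : ℝ) • v))) (f (x + torusProj (h • v))) by
        rw [zero_smul, torusProj_zero, add_zero]
        exact ⟨hy.1.le, hy.2.le⟩)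
    obtain ⟨i, hi⟩ := Set.mem_iUnion.1
      (hX (show (x + torusProj (t • v), y) ∈ torusGraph f from hty.symm))
    refine Set.mem_iUnion.2 ⟨i, ?_⟩
    have h1 : dist (x + torusProj (t • v), y) (z i) ≤ δ := hz i hi
    have h2 : dist (x, y) (x + torusProj (t • v), y) ≤ |h| * ‖v‖ := by
      refine max_le ?_ (by rw [dist_self]; positivity)
      simp only [dist_self_add_right]
      refine (norm_torusProj_le _).trans ?_
      rw [norm_smul, Real.norm_eq_abs]
      have : |t| ≤ |h| := by simpa using Set.abs_sub_left_of_mem_uIcc ht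
      gcongr
    rw [Metric.mem_closedBall]
    linarith [dist_triangle (x, y) (x + torusProj (t • v), y) (z i)]
  have hball : ∀ z : UnitAddTorus (Fin k) × ℝ,
      volume (Metric.closedBall z ρ) ≤ ENNReal.ofReal ((2 * ρ) ^ (k + 1)) := by
    rintro ⟨x, y⟩
    rw [← closedBall_prod_same, Measure.volume_eq_prod, Measure.prod_prod, Real.volume_closedBall,
      pow_succ, ENNReal.ofReal_mul (p := (2 * ρ) ^ k) (by positivity)]
    exact mul_le_mul_left (volume_closedBall_torus_le x hρ0) _
  have h1 := (measure_mono hcov).trans (measure_iUnion_fintype_le volume _)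
  have h2 := h1.trans (Finset.sum_le_sum fun i _ => hball (z i))
  rw [Finset.sum_const, Finset.card_univ, Fintype.card_fin, nsmul_eq_mul,
    ← ENNReal.ofReal_natCast, ← ENNReal.ofReal_mul (by positivity), Measure.volume_eq_prod,
    volume_regionBetween_eq_lintegral hmin.aemeasurable hmax.aemeasurable MeasurableSet.univ,
    Measure.restrict_univ] at h2
  have habs : ∀ x, ((fun x => max (f x) (g x)) - fun x => min (f x) (g x)) x = |g x - f x| :=
    fun x => by rw [Pi.sub_apply, max_sub_min_eq_abs]
  simp only [habs] at h2
  rw [← ofReal_integral_eq_lintegral_ofReal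
    (Continuous.integrable_of_hasCompactSupport (by fun_prop) (HasCompactSupport.of_compactSpace _))
    (Eventually.of_forall fun x => abs_nonneg _),
    ENNReal.ofReal_le_ofReal_iff (by positivity)] at h2
  exact h2

end Graph

/-! ### From directional derivatives to class C^1 -/

/-- A function with continuous directional derivatives along a basis is `C^1`. -/
theorem contDiff_one_of_basis {k : ℕ} {Φ : (Fin k → ℝ) → ℝ} {D : Fin k → (Fin k → ℝ) → ℝ}
    (e : Module.Basis (Fin k) ℝ (Fin k → ℝ)) (hD : ∀ j, Continuous (D j))
    (h : ∀ j y (t : ℝ), HasDerivAt (fun t : ℝ => Φ (y + t • e j)) (D j (y + t • e j)) t) :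
    ContDiff ℝ 1 Φ := by
  let L : Fin k → ((Fin k → ℝ) →L[ℝ] ℝ) := fun j => LinearMap.toContinuousLinearMap (e.coord j)
  rw [contDiff_one_iff_hasFDerivAt]
  refine ⟨fun y => ∑ j, D j y • L j, continuous_finsetSum _ fun j _ =>
    (hD j).smul continuous_const, fun y => ?_⟩
  rw [hasFDerivAt_iff_isLittleO_nhds_zero, Asymptotics.isLittleO_iff]
  intro ε hε
  set K : ℝ := ∑ j, ‖L j‖ + 1 with hK
  have hK0 : 0 < K := by
    have : 0 ≤ ∑ j, ‖L j‖ := Finset.sum_nonneg fun j _ => norm_nonneg _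
    linarith
  -- `K'` keeps the whole coordinate path from y to y + w within distance R of y. The added 1 makes
  -- the constant positive even for an empty sum.
  set K' : ℝ := ∑ j, ‖L j‖ * ‖e j‖ + 1 with hK'
  have hK'0 : 0 < K' := by
    have : 0 ≤ ∑ j, ‖L j‖ * ‖e j‖ := Finset.sum_nonneg fun j _ => by positivity
    linarith
  have hev : ∀ᶠ z in 𝓝 y, ∀ j, |D j z - D j y| ≤ ε / K := by
    rw [eventually_all]
    intro j
    filter_upwards [Metric.tendsto_nhds.1 (hD j).continuousAt (ε / K) (by positivity)] with z hz
    exact hz.le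
  obtain ⟨R, hR0, hR⟩ := Metric.eventually_nhds_iff.1 hev
  filter_upwards [Metric.ball_mem_nhds (0 : Fin k → ℝ) (show 0 < R / K' by positivity)] with w hw
  have hwR : K' * ‖w‖ < R := by
    rw [mem_ball_zero_iff, lt_div_iff₀ hK'0] at hw
    linarith
  have hc : ∀ j, |L j w| ≤ ‖L j‖ * ‖w‖ := fun j => (L j).le_opNorm w
  have hclose : ∀ (s : Finset (Fin k)) (j : Fin k), j ∉ s → ∀ t : ℝ, |t| ≤ |L j w| →
      ‖(∑ i ∈ s, L i w • e i) + t • e j‖ < R := by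
    intro s j hj t ht
    calc ‖(∑ i ∈ s, L i w • e i) + t • e j‖
        ≤ ∑ i ∈ s, ‖L i‖ * ‖w‖ * ‖e i‖ + ‖L j‖ * ‖w‖ * ‖e j‖ := by
          refine (norm_add_le _ _).trans (add_le_add ((norm_sum_le _ _).trans
            (Finset.sum_le_sum fun i _ => ?_)) ?_)
          · rw [norm_smul]
            exact mul_le_mul_of_nonneg_right (hc i) (norm_nonneg _)
          · rw [norm_smul]
            exact mul_le_mul_of_nonneg_right (ht.trans (hc j)) (norm_nonneg _)
      _ = ∑ i ∈ insert j s, ‖L i‖ * ‖w‖ * ‖e i‖ := by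
          rw [Finset.sum_insert hj, add_comm]
      _ ≤ ∑ i, ‖L i‖ * ‖w‖ * ‖e i‖ :=
          Finset.sum_le_univ_sum_of_nonneg fun i => by positivity
      _ = (∑ i, ‖L i‖ * ‖e i‖) * ‖w‖ := by
          rw [Finset.sum_mul]
          exact Finset.sum_congr rfl fun i _ => by ring
      _ ≤ K' * ‖w‖ := mul_le_mul_of_nonneg_right (by rw [hK']; linarith) (norm_nonneg _)
      _ < R := hwR
  have hsum : ∀ s : Finset (Fin k), |Φ (y + ∑ i ∈ s, L i w • e i) - Φ y -
      ∑ i ∈ s, D i y * L i w| ≤ ∑ i ∈ s, ε / K * |L i w| := by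
    intro s
    induction s using Finset.induction_on with
    | empty => simp
    | insert j s hj ih =>
      set z := y + ∑ i ∈ s, L i w • e i with hz
      -- Subtracting the linear part leaves a derivative of size at most ε/K along this leg, so the
      -- mean value inequality applies.
      have hstep : |(Φ (z + L j w • e j) - D j y * L j w) - (Φ z - D j y * 0)| ≤
          ε / K * |L j w| := by
        have := Convex.norm_image_sub_le_of_norm_hasDerivWithin_le (s := Set.uIcc 0 (L j w))
          (x := 0) (y := L j w) (f := fun t => Φ (z + t • e j) - D j y * t)
          (f' := fun t => D j (z + t • e j) - D j y) (C := ε / K)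
          (fun t _ => by
            have hd := ((h j z t).sub ((hasDerivAt_id t).const_mul (D j y))).hasDerivWithinAt
              (s := Set.uIcc 0 (L j w))
            rw [mul_one] at hd
            exact hd)
          (fun t ht => by
            refine hR ?_ j
            have ht' : |t| ≤ |L j w| := by simpa using Set.abs_sub_left_of_mem_uIcc ht
            rw [dist_eq_norm, hz, add_assoc, add_sub_cancel_left]
            exact hclose s j hj t ht')
          (convex_uIcc _ _) Set.left_mem_uIcc Set.right_mem_uIcc
        simpa using this
      rw [Finset.sum_insert hj, Finset.sum_insert hj, Finset.sum_insert hj,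
        add_comm (L j w • e j), ← add_assoc, ← hz]
      calc _ = |((Φ (z + L j w • e j) - D j y * L j w) - (Φ z - D j y * 0)) +
            (Φ z - Φ y - ∑ i ∈ s, D i y * L i w)| := by congr 1; ring
        _ ≤ _ := (abs_add_le _ _).trans (add_le_add hstep ih)
  have hfin := hsum Finset.univ
  have hw' : ∑ i, L i w • e i = w := e.sum_repr w
  rw [hw', ← Finset.mul_sum] at hfin
  have h1 : (∑ j, D j y • L j) w = ∑ i, D i y * L i w := by
    simp
  rw [h1, Real.norm_eq_abs]
  refine hfin.trans ?_
  calc ε / K * ∑ i, |L i w| ≤ ε / K * (K * ‖w‖) := by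
        refine mul_le_mul_of_nonneg_left ?_ (by positivity)
        refine (Finset.sum_le_sum fun i _ => hc i).trans ?_
        rw [← Finset.sum_mul]
        exact mul_le_mul_of_nonneg_right (by rw [hK]; linarith) (norm_nonneg _)
    _ = ε * ‖w‖ := by field_simp

theorem torusContDiff_one_of_basis {k : ℕ} {f : UnitAddTorus (Fin k) → ℝ}
    (e : Module.Basis (Fin k) ℝ (Fin k → ℝ)) (h : ∀ j, ∃ D, HasContDerivAlong f (e j) D) :
    TorusContDiff 1 f := by
  choose D hD using h
  have := contDiff_one_of_basis (Φ := fun y => f (torusProj y))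
    (D := fun j y => D j (torusProj y)) e (fun j => (hD j).1.comp continuous_torusProj)
    (fun j y t => by simpa only [torusProj_add] using (hD j).2 (torusProj y) t)
  exact_mod_cast this

/-! ### Lower bound for the covering numbers -/

section Lower

open MeasureTheory

variable {k : ℕ} {A : Matrix.GeneralLinearGroup (Fin k) ℤ} {lam : ℝ}
  {p D : UnitAddTorus (Fin k) → ℝ} {b : ℝ} {v : Fin k → ℝ}

theorem integrable_of_continuous_torus {f : UnitAddTorus (Fin k) → ℝ} (hf : Continuous f) :
    Integrable f :=
  hf.integrable_of_hasCompactSupport (HasCompactSupport.of_compactSpace _)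

theorem integral_abs_incrementCocycle_pow (hlam : lam ∈ Set.Ioo 0 1) (hbl : |b| < lam)
    (hpc : Continuous p) (hp : HasContDerivAlong p v D) (hb : b ≠ 0)
    (hA : ((A : Matrix (Fin k) (Fin k) ℤ).map (Int.cast : ℤ → ℝ)).mulVec v = b • v)
    (s : ℝ) (n : ℕ) :
    ∫ x, |incrementCocycle A lam p v (b ^ n * s) x| =
      lam ^ n * ∫ x, |incrementCocycle A lam p v s x| := by
  have hmp := measurePreserving_toralMap (A ^ (n : ℤ))
  have hc := (continuous_incrementCocycle hlam hbl hpc hp hb hA (b ^ n * s)).abs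
  have hcomp := integral_map (μ := volume) hmp.measurable.aemeasurable
    (hc.aestronglyMeasurable (μ := Measure.map (toralMap (A ^ (n : ℤ))) volume))
  rw [hmp.map_eq] at hcomp
  rw [hcomp, ← integral_const_mul]
  refine integral_congr_ae (Eventually.of_forall fun x => ?_)
  have := incrementCocycle_zpow (p := p) (lam := lam) hlam.1 hb hA n s x
  rw [zpow_natCast b, zpow_natCast lam] at this
  simp only [this, abs_mul, abs_of_pos (pow_pos hlam.1 n)]

/-- The remainder is O(|b|^n), which is eventually less than half of the cocycle's L^1 norm λ^n J.
Here J > 0 because a continuous function nonzero at one point has positive L^1 norm. -/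
theorem exists_le_integral_abs_skewPhi_sub (hlam : lam ∈ Set.Ioo 0 1) (hbl : |b| < lam)
    (hpc : Continuous p) (hp : HasContDerivAlong p v D) (hb : b ≠ 0)
    (hA : ((A : Matrix (Fin k) (Fin k) ℤ).map (Int.cast : ℤ → ℝ)).mulVec v = b • v)
    {s : ℝ} {x₀ : UnitAddTorus (Fin k)} (hs : incrementCocycle A lam p v s x₀ ≠ 0) :
    ∃ c, 0 < c ∧ ∃ n₀ : ℕ, ∀ n ≥ n₀, c * lam ^ n ≤
      ∫ x, |skewPhi A lam p (x + torusProj ((b ^ n * s) • v)) - skewPhi A lam p x| := by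
  obtain ⟨C, hC0, hC⟩ := exists_abs_cocycleRemainder_le hlam hbl hp hb hA
  set J := ∫ x, |incrementCocycle A lam p v s x| with hJ
  have hcont := continuous_incrementCocycle hlam hbl hpc hp hb hA
  have hφ := continuous_skewPhi (A := A) hlam hpc
  have hJ0 : 0 < J := by
    refine Continuous.integral_pos_of_hasCompactSupport_nonneg_nonzero (x := x₀) (hcont s).abs
      (HasCompactSupport.of_compactSpace _) (fun x => abs_nonneg _) (abs_ne_zero.2 hs)
  have hlim : Tendsto (fun n : ℕ => C * |s| * (|b| / lam) ^ n) atTop (𝓝 0) := by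
    simpa using (tendsto_pow_atTop_nhds_zero_of_lt_one (div_nonneg (abs_nonneg b) hlam.1.le)
      ((div_lt_one hlam.1).2 hbl)).const_mul (C * |s|)
  obtain ⟨n₀, hn₀⟩ := eventually_atTop.1 (hlim.eventually_le_const (half_pos hJ0))
  refine ⟨J / 2, half_pos hJ0, n₀, fun n hn => ?_⟩
  have h1 : ∀ x, |incrementCocycle A lam p v (b ^ n * s) x| - C * (|b| ^ n * |s|) ≤
      |skewPhi A lam p (x + torusProj ((b ^ n * s) • v)) - skewPhi A lam p x| := fun x => by
    rw [incrementCocycle_eq hlam hbl hpc hp hb hA, sub_le_iff_le_add]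
    refine (abs_add_le _ _).trans (add_le_add le_rfl ((hC _ _).trans (le_of_eq ?_)))
    rw [abs_mul, abs_pow]
  have h2 : ∫ x, (|incrementCocycle A lam p v (b ^ n * s) x| - C * (|b| ^ n * |s|)) ≤
      ∫ x, |skewPhi A lam p (x + torusProj ((b ^ n * s) • v)) - skewPhi A lam p x| := by
    refine integral_mono ?_ ?_ h1
    · exact integrable_of_continuous_torus ((hcont _).abs.sub continuous_const)
    · exact integrable_of_continuous_torus
        ((hφ.comp (continuous_id.add continuous_const)).sub hφ).abs
  rw [integral_sub (integrable_of_continuous_torus (hcont _).abs)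
    (integrable_of_continuous_torus continuous_const),
    integral_abs_incrementCocycle_pow hlam hbl hpc hp hb hA, integral_const, Measure.real,
    volume_univ_torus, ENNReal.toReal_one, one_smul] at h2
  refine le_trans ?_ h2
  have h3 := hn₀ n hn
  have hl := pow_pos hlam.1 n
  rw [div_pow] at h3
  have h4 : C * (|b| ^ n * |s|) ≤ J / 2 * lam ^ n := by
    calc _ = (C * |s| * (|b| ^ n / lam ^ n)) * lam ^ n := by field_simp
      _ ≤ _ := by gcongr
  linarith

theorem exists_lower_bound_diamCoveringNumber (hlam : lam ∈ Set.Ioo 0 1) (hbl : |b| < lam)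
    (hpc : Continuous p) (hp : HasContDerivAlong p v D) (hb : b ≠ 0)
    (hA : ((A : Matrix (Fin k) (Fin k) ℤ).map (Int.cast : ℤ → ℝ)).mulVec v = b • v)
    (hs : ∃ s x, incrementCocycle A lam p v s x ≠ 0) :
    ∃ c, 0 < c ∧ ∃ δ₀, 0 < δ₀ ∧ ∀ δ, 0 < δ → δ < δ₀ →
      c * δ ^ (-(k + 1 - Real.log lam / Real.log |b|)) ≤
        diamCoveringNumber (torusGraph (skewPhi A lam p)) δ := by
  obtain ⟨s, x₀, hs⟩ := hs
  obtain ⟨c, hc0, n₀, hc⟩ := exists_le_integral_abs_skewPhi_sub hlam hbl hpc hp hb hA hs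
  have hb0 : 0 < |b| := abs_pos.2 hb
  have hb1 : |b| < 1 := hbl.trans hlam.2
  set α := Real.log lam / Real.log |b| with hα
  have hbα : |b| ^ α = lam := abs_rpow_log_div_log hb0 hb1 hlam.1
  have hα1 : α ≤ 1 := by
    rw [hα, div_le_one_of_neg (Real.log_neg hb0 hb1)]
    exact Real.log_le_log hb0 hbl.le
  set d : ℝ := k + 1 - α with hd
  have hd0 : 0 ≤ d := by have : (0 : ℝ) ≤ k := Nat.cast_nonneg k; linarith
  set K : ℝ := 2 * (1 + |s| * ‖v‖) with hK
  have hK0 : 0 < K := by positivity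
  -- The threshold for δ forces n ≥ n₀ when |b|^{n+1} < δ ≤ |b|^n. The factor |b|^d pays for
  -- replacing |b|^n by δ.
  refine ⟨c / K ^ (k + 1) * |b| ^ d, by positivity, |b| ^ (n₀ + 1), by positivity,
    fun δ hδ hδ₀ => ?_⟩
  have hδ1 : δ ≤ 1 := hδ₀.le.trans (pow_le_one₀ hb0.le hb1.le)
  obtain ⟨n, hn1, hn2⟩ := exists_nat_pow_near_of_lt_one hδ hδ1 hb0 hb1
  have hn : n₀ ≤ n := by
    have := (pow_lt_pow_iff_right_of_lt_one₀ hb0 hb1).1 (hn1.trans hδ₀)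
    omega
  have h1 := (hc n hn).trans (integral_abs_sub_le_diamCoveringNumber_mul
    (continuous_skewPhi (A := A) hlam hpc) v (b ^ n * s) hδ)
  set N : ℝ := (diamCoveringNumber (torusGraph (skewPhi A lam p)) δ : ℝ) with hN
  set r : ℝ := |b| ^ n with hr
  have hr0 : 0 < r := by positivity
  have h2 : c * lam ^ n ≤ N * (K * r) ^ (k + 1) := by
    refine h1.trans ?_
    have h3 : 2 * (δ + |b ^ n * s| * ‖v‖) ≤ K * r := by
      rw [abs_mul, abs_pow, ← hr, hK]
      linarith
    have hN0 : 0 ≤ N := Nat.cast_nonneg _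
    gcongr
  have h3 : lam ^ n = r ^ α := by
    rw [hr, ← hbα, ← Real.rpow_natCast, ← Real.rpow_mul hb0.le, mul_comm, Real.rpow_mul hb0.le,
      Real.rpow_natCast]
  have h4 : c / K ^ (k + 1) * r ^ (-d) ≤ N := by
    rw [h3, mul_pow] at h2
    have h5 : r ^ (-d) = r ^ α / r ^ (k + 1) := by
      rw [hd, show -((k : ℝ) + 1 - α) = α - ((k + 1 : ℕ) : ℝ) by push_cast; ring,
        Real.rpow_sub_natCast hr0.ne']
    rw [h5, div_mul_div_comm, div_le_iff₀ (by positivity)]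
    exact h2
  have h5 : (δ / |b|) ^ (-d) ≤ r ^ (-d) := by
    refine Real.rpow_le_rpow_of_nonpos hr0 ?_ (by linarith)
    rw [le_div_iff₀ hb0, hr, ← pow_succ]
    exact hn1.le
  rw [Real.div_rpow hδ.le hb0.le, Real.rpow_neg hb0.le, div_inv_eq_mul] at h5
  calc _ = c / K ^ (k + 1) * (δ ^ (-d) * |b| ^ d) := by ring
    _ ≤ c / K ^ (k + 1) * r ^ (-d) := by gcongr
    _ ≤ N := h4

end Lower

/-- A continuous function that is `α`-Hölder along every vector of a basis and whose graph has
covering numbers bounded below by a multiple of `δ ^ (-(k + 1 - α))` has a graph of box dimension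
`k + 1 - α`. -/
theorem hasBoxDim_torusGraph {k : ℕ} {f : UnitAddTorus (Fin k) → ℝ} (hf : Continuous f) {α : ℝ}
    (hα0 : 0 < α) (hα1 : α ≤ 1) (e : Module.Basis (Fin k) ℝ (Fin k → ℝ))
    (hH : ∀ j, IsHolderAlong f (e j) α) {c δ₀ : ℝ} (hc : 0 < c) (hδ₀ : 0 < δ₀)
    (hlow : ∀ δ, 0 < δ → δ < δ₀ → c * δ ^ (-(k + 1 - α)) ≤ diamCoveringNumber (torusGraph f) δ) :
    HasBoxDim (torusGraph f) (k + 1 - α) := by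
  obtain ⟨C, hC0, hC⟩ := exists_holder_of_isHolderAlong_basis hα0 e hH
  exact hasBoxDim_of_bounds torusGraph_nonempty (totallyBounded_torusGraph hf) hc
    (C := 2 ^ k * (2 * C + 1)) (by positivity) (lt_min hδ₀ one_pos)
    (fun δ h0 h1 => hlow δ h0 (h1.trans_le (min_le_left _ _)))
    (fun δ h0 h1 => diamCoveringNumber_torusGraph_le hα1 hC0 hα0 hC h0
      (h1.trans_le (min_le_right _ _)))

end

/-! ### Assembly -/

theorem mainTheorem2
    (k : ℕ) (A : Matrix.GeneralLinearGroup (Fin k) ℤ)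
    (B : Fin k → ℝ) (v : Fin k → Fin k → ℝ)
    (hv : ∀ i, v i ≠ 0)
    (hAv : ∀ i, ((A : Matrix (Fin k) (Fin k) ℤ).map (Int.cast : ℤ → ℝ)).mulVec (v i) = B i • v i)
    (hB : StrictMono fun i => |B i|)
    (hyp : ∀ i, |B i| ≠ 1)
    (p : UnitAddTorus (Fin k) → ℝ) (hp : TorusContDiff (k + 1) p)
    (lam : ℝ) (l : ℕ) (hl : l + 1 < k)
    (hlam : lam ∈ Set.Ioo |B ⟨l, Nat.lt_of_succ_lt hl⟩| |B ⟨l + 1, hl⟩| ∩ Set.Ioo 0 1) :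
    ((∃ i : Fin k, i.val ≤ l ∧ HasNonzeroCoeff A lam p (B i) (v i)) →
      ∃ i₀ : Fin k, IsLeast {i : Fin k | i.val ≤ l ∧ HasNonzeroCoeff A lam p (B i) (v i)} i₀ ∧
        HasBoxDim (torusGraph (skewPhi A lam p))
          (k + 1 - Real.log lam / Real.log |B i₀|)) ∧
    ((∀ i : Fin k, i.val ≤ l → ¬ HasNonzeroCoeff A lam p (B i) (v i)) →
      TorusContDiff 1 (skewPhi A lam p) ∧ HasBoxDim (torusGraph (skewPhi A lam p)) k) := by
  obtain ⟨⟨hlam1, hlam2⟩, hlam01⟩ := hlam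
  have hpc : Continuous p := hp.continuous
  have hφ : Continuous (skewPhi A lam p) := continuous_skewPhi hlam01 hpc
  obtain ⟨e, he⟩ := exists_basis_of_eigenvectors (by omega) hv hAv hB
  have hb : ∀ i, B i ≠ 0 := fun i => eigenvalue_ne_zero (hv i) (hAv i)
  -- Indices start at 0, so `l` here is one less than in the informal statement; `i.val ≤ l` selects
  -- exactly the directions with `|B i| < lam`.
  have hle : ∀ i : Fin k, i.val ≤ l → |B i| < lam := fun i hi =>
    (hB.monotone (show i ≤ ⟨l, Nat.lt_of_succ_lt hl⟩ from hi)).trans_lt hlam1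
  have hgt : ∀ i : Fin k, ¬ i.val ≤ l → lam < |B i| := fun i hi =>
    hlam2.trans_le (hB.monotone (show (⟨l + 1, hl⟩ : Fin k) ≤ i from not_le.1 hi))
  choose D hD using fun i => hp.exists_hasContDerivAlong (by omega) (v i)
  have hiff : ∀ i : Fin k, i.val ≤ l → (HasNonzeroCoeff A lam p (B i) (v i) ↔
      ∃ s x, incrementCocycle A lam p (v i) s x ≠ 0) := fun i hi =>
    hasNonzeroCoeff_iff hlam01 (hle i hi) hpc (hD i) (hb i) (hAv i)
  have hC1 : ∀ i : Fin k, ¬ (i.val ≤ l ∧ HasNonzeroCoeff A lam p (B i) (v i)) →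
      ∃ D', HasContDerivAlong (skewPhi A lam p) (v i) D' := by
    intro i hi
    by_cases hil : i.val ≤ l
    · refine exists_hasContDerivAlong_skewPhi_of_incrementCocycle_eq_zero hlam01 (hle i hil) hpc
        (hD i) (hb i) (hAv i) fun s x => ?_
      by_contra h0
      exact hi ⟨hil, (hiff i hil).2 ⟨s, x, h0⟩⟩
    · exact exists_hasContDerivAlong_skewPhi_of_lt hlam01 hpc (hD i) (hb i) (hAv i) (hgt i hil)
  have hloglam := Real.log_neg hlam01.1 hlam01.2
  have hlog : ∀ i : Fin k, i.val ≤ l → Real.log |B i| < 0 := fun i hi =>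
    Real.log_neg (abs_pos.2 (hb i)) ((hle i hi).trans hlam01.2)
  constructor
  · intro hex
    obtain ⟨i₀, hi₀⟩ : ∃ i₀, IsLeast
        {i : Fin k | i.val ≤ l ∧ HasNonzeroCoeff A lam p (B i) (v i)} i₀ := by
      have hfin := Set.toFinite {i : Fin k | i.val ≤ l ∧ HasNonzeroCoeff A lam p (B i) (v i)}
      obtain ⟨i₀, hi₀, hmin⟩ := hfin.exists_minimal hex
      exact ⟨i₀, hi₀, fun j hj => (le_total i₀ j).elim id fun h => hmin hj h⟩
    refine ⟨i₀, hi₀, ?_⟩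
    have hl₀ := hi₀.1.1
    have hα0 : 0 < Real.log lam / Real.log |B i₀| := div_pos_of_neg_of_neg hloglam (hlog i₀ hl₀)
    have hα1 : Real.log lam / Real.log |B i₀| ≤ 1 := by
      rw [div_le_one_of_neg (hlog i₀ hl₀)]
      exact Real.log_le_log (abs_pos.2 (hb i₀)) (hle i₀ hl₀).le
    obtain ⟨c, hc, δ₀, hδ₀, hlow⟩ := exists_lower_bound_diamCoveringNumber hlam01 (hle i₀ hl₀) hpc
      (hD i₀) (hb i₀) (hAv i₀) ((hiff i₀ hl₀).1 hi₀.1.2)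
    refine hasBoxDim_torusGraph hφ hα0 hα1 e (fun j => ?_) hc hδ₀ hlow
    rw [he]
    by_cases hj : j.val ≤ l ∧ HasNonzeroCoeff A lam p (B j) (v j)
    -- Since log λ and both eigenvalue logarithms are negative, a larger |B j| gives a larger Hölder
    -- exponent; the least index therefore gives the weakest regularity.
    · refine (isHolderAlong_skewPhi hlam01 (hle j hj.1) hpc (hD j) (hb j) (hAv j)).mono hφ hα0 ?_
      rw [div_eq_mul_inv, div_eq_mul_inv]
      refine mul_le_mul_of_nonpos_left ?_ hloglam.le
      rw [inv_le_inv_of_neg (hlog j hj.1) (hlog i₀ hl₀)]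
      exact Real.log_le_log (abs_pos.2 (hb i₀)) (hB.monotone (hi₀.2 hj))
    · obtain ⟨D', hD'⟩ := hC1 j hj
      exact hD'.isHolderAlong hφ hα0 hα1
  · intro hno
    have hC1' : ∀ j, ∃ D', HasContDerivAlong (skewPhi A lam p) (e j) D' := fun j => by
      rw [he]
      exact hC1 j fun h => hno j h.1 h.2
    refine ⟨torusContDiff_one_of_basis e hC1', ?_⟩
    -- This is the case α = 1, where k + 1 - α = k.
    have h := hasBoxDim_torusGraph hφ one_pos le_rfl e (fun j => by
      obtain ⟨D', hD'⟩ := hC1' j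
      exact hD'.isHolderAlong hφ one_pos le_rfl) (c := (2 ^ k)⁻¹) (δ₀ := 1) (by positivity) one_pos
      (fun δ hδ _ => by
        have h1 := one_le_diamCoveringNumber_mul hφ hδ
        rw [add_sub_cancel_right, Real.rpow_neg hδ.le, Real.rpow_natCast, ← mul_inv, ← mul_pow]
        exact (inv_le_iff_one_le_mul₀ (by positivity)).2 h1)
    rwa [add_sub_cancel_right] at h
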